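/- Let $n\ge 1$. A convex body in $\mathbb{R}^n$ is a compact convex set $K$ with non-empty interior; it is isotropic if $X=(X_1,\dots,X_n)$ uniformly distributed on $K$ satisfies $\mathbb{E}[X]=0$ and $\mathbb{E}[X_iX_j]=\delta_{ij}$ for all $i,j$. A cone is the convex hull of a subset (the base) of an affine hyperplane together with a point outside that hyperplane. Let $K\subset\mathbb{R}^n$ be an isotropic convex body, let $X$ be uniformly distributed on $K$, and let $\Gamma_n$ be uniformly distributed on an $n$-dimensional simplex $\Delta_n\subset\mathbb{R}^n$ that is isotropic. Let $k\in\{3,4\}$ and let $\varphi\in C^k(\mathbb{R})$ satisfy $\varphi^{(k)}(x)>0$ for all $x\in\mathbb{R}$. Then both maxima below are attained and $$\max_{\theta\in S^{n-1}}\mathbb{E}[\varphi(X\cdot\theta)]\;\le\;\max_{\theta\in S^{n-1}}\mathbb{E}[\varphi(\Gamma_n\cdot\theta)].$$ If $k=3$, equality holds if and only if $K$ is a cone, and in that case every unit vector $\theta$ at which the maximum on the left is attained is normal to the hyperplane of a base of $K$ (that is, to an affine hyperplane $H$ such that $K$ is the convex hull of a subset of $H$ and a point outside $H$). If $k=4$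 this is no longer so: there are a dimension $n$, a function $\varphi\in C^4(\mathbb{R})$ with $\varphi^{(4)}>0$ and an isotropic convex body $K\subset\mathbb{R}^n$ that is not a cone, for which equality holds. -/

import Mathlib

open MeasureTheory ProbabilityTheory

noncomputable section

/-- A convex body: a compact convex set with non-empty interior. -/
def IsConvexBody {n : ℕ} (K : Set (EuclideanSpace ℝ (Fin n))) : Prop :=
  Convex ℝ K ∧ IsCompact K ∧ (interior K).Nonempty

/-- The law `Uni(K)`: Lebesgue measure restricted to `K` and normalized. -/
def uniformLaw {n : ℕ} (K : Set (EuclideanSpace ℝ (Fin n))) :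
    Measure (EuclideanSpace ℝ (Fin n)) :=
  ProbabilityTheory.cond volume K

/-- `K` is in isotropic position: `X ∼ Uni(K)` has `E[X] = 0` and `E[X_i X_j] = δ_{ij}`. -/
def IsIsotropic {n : ℕ} (K : Set (EuclideanSpace ℝ (Fin n))) : Prop :=
  (∀ i : Fin n, ∫ x, x i ∂(uniformLaw K) = 0) ∧
    ∀ i j : Fin n, ∫ x, x i * x j ∂(uniformLaw K) = if i = j then 1 else 0

/-- A (non-degenerate) `n`-dimensional simplex in `ℝⁿ`. -/
def IsSimplex {n : ℕ} (K : Set (EuclideanSpace ℝ (Fin n))) : Prop :=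
  ∃ v : Fin (n + 1) → EuclideanSpace ℝ (Fin n),
    AffineIndependent ℝ v ∧ K = convexHull ℝ (Set.range v)

/-- `H` is an affine subspace of codimension one in `ℝⁿ`. -/
def IsAffineHyperplane {n : ℕ} (H : AffineSubspace ℝ (EuclideanSpace ℝ (Fin n))) : Prop :=
  (H : Set (EuclideanSpace ℝ (Fin n))).Nonempty ∧ Module.finrank ℝ H.direction + 1 = n

/-- `K` is a cone whose base lies in the affine hyperplane `H`: the convex hull of a subset of `H`
and a point outside of `H`. -/
def IsConeWithBaseIn {n : ℕ} (K : Set (EuclideanSpace ℝ (Fin n)))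
    (H : AffineSubspace ℝ (EuclideanSpace ℝ (Fin n))) : Prop :=
  IsAffineHyperplane H ∧
    ∃ (B : Set (EuclideanSpace ℝ (Fin n))) (p : EuclideanSpace ℝ (Fin n)),
      B ⊆ (H : Set (EuclideanSpace ℝ (Fin n))) ∧ p ∉ H ∧ K = convexHull ℝ (insert p B)

/-- `K` is a cone. -/
def IsCone {n : ℕ} (K : Set (EuclideanSpace ℝ (Fin n))) : Prop :=
  ∃ H : AffineSubspace ℝ (EuclideanSpace ℝ (Fin n)), IsConeWithBaseIn K H

/-- `E[φ(X · θ)]` for `X ∼ Uni(K)`. -/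
def marginalExp {n : ℕ} (K : Set (EuclideanSpace ℝ (Fin n))) (φ : ℝ → ℝ)
    (θ : EuclideanSpace ℝ (Fin n)) : ℝ :=
  ∫ x, φ (inner ℝ x θ) ∂(uniformLaw K)

/-- `M = max_{θ ∈ S^{n-1}} E[φ(X · θ)]` for `X ∼ Uni(K)`; the maximum is attained. -/
def IsMaxMarginal {n : ℕ} (K : Set (EuclideanSpace ℝ (Fin n))) (φ : ℝ → ℝ) (M : ℝ) : Prop :=
  IsGreatest (marginalExp K φ '' Metric.sphere (0 : EuclideanSpace ℝ (Fin n)) 1) M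

end

/-! Write `n = p + 1`. The variable `X · θ` has a density `f`, the normalized volume of the sections
of `K` orthogonal to `θ`, and by Brunn's theorem (`volume_section_combo`) `f ^ (1 / p)` is concave
on its support. Isotropy fixes the moments of order 0, 1 and 2 of every such density. So the problem
is to compare two densities on the line with equal low moments.

The comparison tool is `integral_mul_nonpos_of_list_sign`. Let `D = f - g` have vanishing moments of
order `< k` and at most `k` sign changes, with `D ≤ 0` to the right of the last one. Subtract from
`φ` its interpolation polynomial at the sign changes. This leaves `∫ D φ` unchanged, and since the
`k`-th derivative is positive the remainder has the sign opposite to that of `D`. Hence `∫ D φ ≤ 0`,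
with equality only if `D = 0` almost everywhere. With fewer than `k` sign changes `D` must vanish
anyway.

For `k = 3`, take for `g` the marginal of a cone along the normal of its base. There `g ^ (1 / p)`
is affine, and a concave function crosses an affine one at most twice, so three sign changes suffice
(`TentDensity.sign_changes_cone`). A simplex is a cone, which gives the inequality. Equality forces
the two marginal laws to coincide. Then the part of `K` above each level has the volume of a
homothetic copy of `K` which it contains, so `K` is a cone (`TentDirection.of_map_eq`). Conversely,
if `K` is a cone the roles of `K` and the simplex can be exchanged.

For `k = 4` the third moments must agree too. `IsSimplex.exists_path` joins a direction maximizing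
the third moment of the simplex to one minimizing it, through directions whose marginals are tents:
the root is affine on each side of a peak. By the intermediate value theorem some direction on the
path has the third moment of the given marginal of `K`, and against a tent there are at most four
sign changes (`TentDensity.sign_changes`).

For the failure of the equality case, the square along its diagonal and the regular triangle along a
side have the same symmetric tent as marginal. With `φ = t ^ 4` both maxima equal `12 / 5`. -/

/-! ### Vanishing moments, sign changes and polynomial interpolation. -/

/-- Iterated Rolle theorem. -/
theorem exists_iteratedDeriv_eq_zero (m : ℕ) : ∀ (h : ℝ → ℝ), ContDiff ℝ m h →
    ∀ x : Fin (m + 1) → ℝ, StrictMono x → (∀ i, h (x i) = 0) → ∃ ξ, iteratedDeriv m h ξ = 0 := by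
  induction m with
  | zero =>
    intro h _ x _ hx
    exact ⟨x 0, by simpa using hx 0⟩
  | succ m ih =>
    intro h hh x hxm hx
    have hd : ∀ i : Fin (m + 1), ∃ y ∈ Set.Ioo (x i.castSucc) (x i.succ), deriv h y = 0 := fun i =>
      exists_deriv_eq_zero (hxm Fin.castSucc_lt_succ) hh.continuous.continuousOn
        ((hx _).trans (hx _).symm)
    choose y hy hy0 using hd
    have hh' : ContDiff ℝ m (deriv h) := by
      have : ContDiff ℝ ((m : WithTop ℕ∞) + 1) h := by exact_mod_cast hh
      exact (contDiff_succ_iff_deriv.1 this).2.2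
    have hmono : StrictMono y := fun i j hij => by
      have : x i.succ ≤ x j.castSucc := hxm.monotone (by rw [Fin.le_def]; exact hij)
      linarith [(hy i).2, (hy j).1]
    obtain ⟨ξ, hξ⟩ := ih (deriv h) hh' y hmono hy0
    exact ⟨ξ, by rw [iteratedDeriv_succ']; exact hξ⟩

theorem iteratedDeriv_polynomial_eval (R : Polynomial ℝ) (k : ℕ) :
    iteratedDeriv k (fun t => R.eval t) = fun t => (Polynomial.derivative^[k] R).eval t := by
  induction k generalizing R with
  | zero => rfl
  | succ k ih =>
    rw [iteratedDeriv_succ', Function.iterate_succ_apply, ← ih]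
    congr 1
    ext t
    simp

theorem iterate_derivative_eval_of_natDegree_le (R : Polynomial ℝ) (k : ℕ) (hR : R.natDegree ≤ k)
    (t : ℝ) : (Polynomial.derivative^[k] R).eval t = k.factorial * R.coeff k := by
  have h0 : (Polynomial.derivative^[k] R).natDegree ≤ 0 :=
    (Polynomial.natDegree_iterate_derivative R k).trans (by omega)
  rw [Polynomial.eq_C_of_natDegree_le_zero h0, Polynomial.eval_C,
    Polynomial.coeff_iterate_derivative]
  simp [Nat.descFactorial_self]

/-- The sign of the error of polynomial interpolation at `k` distinct nodes. -/
theorem exists_interpolation_sign (S : Finset ℝ) {φ : ℝ → ℝ} (hφ : ContDiff ℝ S.card φ)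
    (hpos : ∀ x, 0 < iteratedDeriv S.card φ x) :
    ∃ q : Polynomial ℝ, (q = 0 ∨ q.natDegree < S.card) ∧
      ∀ t ∉ S, 0 < (φ t - q.eval t) * ∏ x ∈ S, (t - x) := by
  classical
  set q := Lagrange.interpolate S id φ with hq
  have hinj : Set.InjOn (id : ℝ → ℝ) S := Function.injective_id.injOn
  have hdeg : q.degree < S.card := Lagrange.degree_interpolate_lt φ hinj
  -- The alternative `q = 0` is needed for empty `S`, since `natDegree 0 = 0` is not less than `0`.
  have hdeg' : q = 0 ∨ q.natDegree < S.card := by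
    by_cases h : q = 0
    · exact Or.inl h
    · exact Or.inr ((Polynomial.natDegree_lt_iff_degree_lt h).2 hdeg)
  refine ⟨q, hdeg', fun t ht => ?_⟩
  set N : Polynomial ℝ := ∏ x ∈ S, (Polynomial.X - Polynomial.C x) with hN
  have hNe : ∀ s, N.eval s = ∏ x ∈ S, (s - x) := fun s => by
    simp [hN, Polynomial.eval_prod]
  have hNm : N.Monic := Polynomial.monic_prod_of_monic _ _ fun x _ => Polynomial.monic_X_sub_C x
  have hNd : N.natDegree = S.card := by
    rw [hN, Polynomial.natDegree_prod_of_monic _ _ fun x _ => Polynomial.monic_X_sub_C x]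
    simp
  have hNt : N.eval t ≠ 0 := by
    rw [hNe]
    exact Finset.prod_ne_zero_iff.2 fun x hx => sub_ne_zero.2 fun h => ht (h ▸ hx)
  -- With this `c` the polynomial `R` agrees with `φ` at `t` as well as on `S`. Iterated Rolle at
  -- these `S.card + 1` points gives `φ^(k)(ξ) = k! c` with `k = S.card`, so `c > 0`.
  set c := (φ t - q.eval t) / N.eval t with hc
  set R : Polynomial ℝ := q + Polynomial.C c * N with hR
  have hRd : R.natDegree ≤ S.card := by
    refine (Polynomial.natDegree_add_le _ _).trans (max_le ?_ ?_)
    · rcases hdeg' with h | h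
      · simp [h]
      · exact h.le
    · exact (Polynomial.natDegree_C_mul_le _ _).trans hNd.le
  have hRc : R.coeff S.card = c := by
    rw [hR, Polynomial.coeff_add, Polynomial.coeff_C_mul, Polynomial.coeff_eq_zero_of_degree_lt hdeg,
      ← hNd, hNm.coeff_natDegree]
    simp
  have hRcd : ContDiff ℝ S.card (fun s => R.eval s) :=
    Polynomial.contDiff_aeval R _
  have hcard : (insert t S).card = S.card + 1 := Finset.card_insert_of_notMem ht
  obtain ⟨ξ, hξ⟩ := exists_iteratedDeriv_eq_zero S.card (fun s => φ s - R.eval s)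
    (hφ.sub hRcd) ((insert t S).orderEmbOfFin hcard) (OrderEmbedding.strictMono _) (fun i => by
      have hm := (insert t S).orderEmbOfFin_mem hcard i
      rcases Finset.mem_insert.1 hm with h | h
      · rw [h, hR, Polynomial.eval_add, Polynomial.eval_mul, Polynomial.eval_C, hc]
        field_simp
        ring
      · have h1 : N.eval ((insert t S).orderEmbOfFin hcard i) = 0 := by
          rw [hNe]; exact Finset.prod_eq_zero h (sub_self _)
        have h2 : q.eval ((insert t S).orderEmbOfFin hcard i)
            = φ ((insert t S).orderEmbOfFin hcard i) :=
          Lagrange.eval_interpolate_at_node φ hinj h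
        rw [hR, Polynomial.eval_add, Polynomial.eval_mul, h1, h2]
        simp)
  have hsub : iteratedDeriv S.card (fun s => φ s - R.eval s) ξ =
      iteratedDeriv S.card φ ξ - iteratedDeriv S.card (fun s => R.eval s) ξ :=
    iteratedDeriv_fun_sub hφ.contDiffAt hRcd.contDiffAt
  rw [hsub, iteratedDeriv_polynomial_eval] at hξ
  beta_reduce at hξ
  rw [iterate_derivative_eval_of_natDegree_le R _ hRd, hRc]
    at hξ
  have hcpos : 0 < c := by
    have := hpos ξ
    have hf : (0 : ℝ) < S.card.factorial := by positivity
    by_contra hcon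
    nlinarith
  have : φ t - q.eval t = c * N.eval t := by rw [hc]; field_simp
  rw [this, ← hNe, mul_assoc]
  exact mul_pos hcpos (mul_self_pos.2 hNt)

/-- Squares do not matter for the sign of a product of linear factors. -/
theorem exists_finset_prod_sign (L : List ℝ) : ∃ S : Finset ℝ, S.card ≤ L.length ∧
    ∀ t ∉ L, t ∉ S ∧ 0 < (∏ x ∈ S, (t - x)) * (L.map fun x => t - x).prod := by
  classical
  induction L with
  | nil => exact ⟨∅, by simp, by simp⟩
  | cons a L ih =>
    obtain ⟨S, hc, hS⟩ := ih
    by_cases ha : a ∈ S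
    · refine ⟨S.erase a, ?_, fun t ht => ?_⟩
      · have := Finset.card_erase_le (s := S) (a := a)
        simp only [List.length_cons]; omega
      · simp only [List.mem_cons, not_or] at ht
        obtain ⟨h1, h2⟩ := hS t ht.2
        refine ⟨fun h => h1 (Finset.mem_of_mem_erase h), ?_⟩
        rw [← Finset.mul_prod_erase S _ ha] at h2
        simp only [List.map_cons, List.prod_cons]
        linarith
    · refine ⟨insert a S, ?_, fun t ht => ?_⟩
      · have := Finset.card_insert_le a S
        simp only [List.length_cons]; omega
      · simp only [List.mem_cons, not_or] at ht
        obtain ⟨h1, h2⟩ := hS t ht.2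
        refine ⟨by simp [ht.1, h1], ?_⟩
        rw [Finset.prod_insert ha]
        simp only [List.map_cons, List.prod_cons]
        have : 0 < (t - a) * (t - a) := mul_self_pos.2 (sub_ne_zero.2 ht.1)
        nlinarith

theorem ae_notMem_list (L : List ℝ) : ∀ᵐ t : ℝ, t ∉ L := by
  have h : {t | ¬ t ∉ L} = (L.toFinset : Set ℝ) := by ext; simp
  rw [ae_iff, h]
  exact (L.toFinset.finite_toSet).measure_zero _

/-- An integrable function with bounded support. -/
structure IntegrableBddSupport (D : ℝ → ℝ) : Prop where
  integrable : Integrable D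
  bounded : ∃ R : ℝ, ∀ t, R < |t| → D t = 0

theorem IntegrableBddSupport.mul_continuous {D φ : ℝ → ℝ} (hD : IntegrableBddSupport D)
    (hφ : Continuous φ) : Integrable fun t => D t * φ t := by
  obtain ⟨R, hR⟩ := hD.bounded
  have h1 : (Set.Icc (-R) R).indicator (fun t => D t * φ t) = fun t => D t * φ t := by
    ext t
    by_cases ht : t ∈ Set.Icc (-R) R
    · simp [ht]
    · have : R < |t| := by
        by_contra hcon
        exact ht (abs_le.1 (not_lt.1 hcon))
      simp [ht, hR t this]
  rw [← h1, integrable_indicator_iff measurableSet_Icc]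
  exact hD.integrable.integrableOn.mul_continuousOn hφ.continuousOn isCompact_Icc

theorem IntegrableBddSupport.sub {f g : ℝ → ℝ} (hf : IntegrableBddSupport f)
    (hg : IntegrableBddSupport g) : IntegrableBddSupport fun t => f t - g t := by
  obtain ⟨R, hR⟩ := hf.bounded
  obtain ⟨R', hR'⟩ := hg.bounded
  refine ⟨hf.integrable.sub hg.integrable, max R R', fun t ht => ?_⟩
  rw [hR t ((le_max_left _ _).trans_lt ht), hR' t ((le_max_right _ _).trans_lt ht), sub_zero]

theorem integral_mul_polynomial_eq_zero {D : ℝ → ℝ} (hD : IntegrableBddSupport D) {k : ℕ}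
    (hm : ∀ j < k, ∫ t, D t * t ^ j = 0) (q : Polynomial ℝ) (hq : q = 0 ∨ q.natDegree < k) :
    ∫ t, D t * q.eval t = 0 := by
  rcases hq with rfl | hq
  · simp
  · have : ∀ t, D t * q.eval t = ∑ i ∈ Finset.range k, q.coeff i * (D t * t ^ i) := fun t => by
      rw [Polynomial.eval_eq_sum_range' hq, Finset.mul_sum]
      exact Finset.sum_congr rfl fun i _ => by ring
    simp_rw [this]
    rw [integral_finsetSum]
    · refine Finset.sum_eq_zero fun i hi => ?_
      rw [integral_const_mul, hm i (Finset.mem_range.1 hi), mul_zero]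
    · exact fun i _ => (hD.mul_continuous (continuous_pow i)).const_mul _

/-- A function with vanishing moments of order `< k` and fewer than `k` sign changes vanishes. -/
theorem ae_eq_zero_of_prod_sign {D : ℝ → ℝ} (hD : IntegrableBddSupport D) {k : ℕ}
    (hm : ∀ j < k, ∫ t, D t * t ^ j = 0) (S : Finset ℝ) (hS : S.card < k)
    (hs : ∀ᵐ t, D t * ∏ x ∈ S, (t - x) ≤ 0) : D =ᵐ[volume] 0 := by
  set N : Polynomial ℝ := ∏ x ∈ S, (Polynomial.X - Polynomial.C x) with hN
  have hNe : ∀ s, N.eval s = ∏ x ∈ S, (s - x) := fun s => by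
    simp [hN, Polynomial.eval_prod]
  have hNd : N.natDegree = S.card := by
    rw [hN, Polynomial.natDegree_prod_of_monic _ _ fun x _ => Polynomial.monic_X_sub_C x]
    simp
  -- The nodal polynomial has degree `< k`, so it is orthogonal to `D`; but its product with `D` has
  -- constant sign.
  have h0 := integral_mul_polynomial_eq_zero hD hm N (Or.inr (hNd ▸ hS))
  have hi : Integrable fun t => -(D t * N.eval t) := (hD.mul_continuous N.continuous).neg
  have h1 : (fun t => -(D t * N.eval t)) =ᵐ[volume] 0 := by
    rw [← integral_eq_zero_iff_of_nonneg_ae _ hi]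
    · rw [integral_neg, h0, neg_zero]
    · filter_upwards [hs] with t ht
      rw [hNe]
      simpa using ht
  have h2 : ∀ᵐ t : ℝ, t ∉ S := by
    simpa using ae_notMem_list S.toList
  filter_upwards [h1, h2] with t ht ht'
  have : N.eval t ≠ 0 := by
    rw [hNe]
    exact Finset.prod_ne_zero_iff.2 fun x hx => sub_ne_zero.2 fun h => ht' (h ▸ hx)
  simpa [this] using ht

/-- Lists rather than finsets of nodes: the sign-change points found below may coincide, and a node
of even multiplicity is no sign change. -/
theorem ae_eq_zero_of_list_sign {D : ℝ → ℝ} (hD : IntegrableBddSupport D) {k : ℕ}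
    (hm : ∀ j < k, ∫ t, D t * t ^ j = 0) (L : List ℝ) (hL : L.length < k)
    (hs : ∀ᵐ t, D t * (L.map fun x => t - x).prod ≤ 0) : D =ᵐ[volume] 0 := by
  obtain ⟨S, hc, hS⟩ := exists_finset_prod_sign L
  refine ae_eq_zero_of_prod_sign hD hm S (hc.trans_lt hL) ?_
  filter_upwards [hs, ae_notMem_list L] with t ht htL
  have h := (hS t htL).2
  by_contra hcon
  push Not at hcon
  rcases pos_and_pos_or_neg_and_neg_of_mul_pos h with ⟨h1, h2⟩ | ⟨h1, h2⟩ <;> nlinarith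

/-- Subtracting the interpolant `q` of degree `< k` does not change `∫ D φ`, and `φ - q` has the
sign of the nodal product, opposite to that of `D`. If repeated nodes cancel, fewer than `k` are
left and `D` vanishes. -/
theorem integral_mul_nonpos_of_list_sign {D : ℝ → ℝ} (hD : IntegrableBddSupport D) {k : ℕ}
    (hm : ∀ j < k, ∫ t, D t * t ^ j = 0) (L : List ℝ) (hL : L.length ≤ k)
    (hs : ∀ᵐ t, D t * (L.map fun x => t - x).prod ≤ 0)
    {φ : ℝ → ℝ} (hφ : ContDiff ℝ k φ) (hpos : ∀ x, 0 < iteratedDeriv k φ x) :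
    ∫ t, D t * φ t ≤ 0 ∧ (∫ t, D t * φ t = 0 → D =ᵐ[volume] 0) := by
  obtain ⟨S, hc, hS⟩ := exists_finset_prod_sign L
  have hs' : ∀ᵐ t, D t * ∏ x ∈ S, (t - x) ≤ 0 := by
    filter_upwards [hs, ae_notMem_list L] with t ht htL
    have h := (hS t htL).2
    by_contra hcon
    push Not at hcon
    rcases pos_and_pos_or_neg_and_neg_of_mul_pos h with ⟨h1, h2⟩ | ⟨h1, h2⟩ <;> nlinarith
  rcases (hc.trans hL).lt_or_eq with hlt | heq
  · have h0 := ae_eq_zero_of_prod_sign hD hm S hlt hs'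
    refine ⟨le_of_eq ?_, fun _ => h0⟩
    refine integral_eq_zero_of_ae ?_
    filter_upwards [h0] with t ht
    simp [ht]
  · subst heq
    obtain ⟨q, hq, hqs⟩ := exists_interpolation_sign S hφ hpos
    have h2 : ∀ᵐ t : ℝ, t ∉ S := by simpa using ae_notMem_list S.toList
    have hint : ∫ t, D t * φ t = ∫ t, D t * (φ t - q.eval t) := by
      have := integral_sub (hD.mul_continuous hφ.continuous) (hD.mul_continuous q.continuous)
      rw [integral_mul_polynomial_eq_zero hD hm q hq, sub_zero] at this
      rw [← this]
      exact integral_congr_ae (Filter.Eventually.of_forall fun t => by ring)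
    have hle : ∀ᵐ t, D t * (φ t - q.eval t) ≤ 0 := by
      filter_upwards [hs', h2] with t ht htS
      have h := hqs t htS
      by_contra hcon
      push Not at hcon
      rcases pos_and_pos_or_neg_and_neg_of_mul_pos h with ⟨h1, h2⟩ | ⟨h1, h2⟩ <;> nlinarith
    rw [hint]
    refine ⟨integral_nonpos_of_ae hle, fun h0 => ?_⟩
    have hi : Integrable fun t => -(D t * (φ t - q.eval t)) :=
      (hD.mul_continuous (hφ.continuous.sub q.continuous)).neg
    have h1 : (fun t => -(D t * (φ t - q.eval t))) =ᵐ[volume] 0 := by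
      rw [← integral_eq_zero_iff_of_nonneg_ae _ hi]
      · rw [integral_neg, h0, neg_zero]
      · filter_upwards [hle] with t ht
        simpa using ht
    filter_upwards [h1, h2] with t ht htS
    have h := hqs t htS
    have : φ t - q.eval t ≠ 0 := fun h' => by simp [h'] at h
    simpa [this] using ht

/-! ### Brunn's theorem on the sections of a convex set. -/

/-- The Brunn-Minkowski inequality for intervals. -/
theorem volume_add_le_of_combo_mem {A B C : Set ℝ} {a b : ℝ} (ha : 0 < a) (hb : 0 < b)
    (hA : A.OrdConnected) (hB : B.OrdConnected) (hA0 : A.Nonempty) (hB0 : B.Nonempty)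
    (hAb : Bornology.IsBounded A) (hBb : Bornology.IsBounded B)
    (hC : ∀ x ∈ A, ∀ y ∈ B, a * x + b * y ∈ C) :
    ENNReal.ofReal a * volume A + ENNReal.ofReal b * volume B ≤ volume C := by
  have key : ∀ {A : Set ℝ}, A.OrdConnected → A.Nonempty → Bornology.IsBounded A →
      0 ≤ sSup A - sInf A ∧ volume A ≤ ENNReal.ofReal (sSup A - sInf A) ∧
      ∀ τ ∈ Set.Ioo (0 : ℝ) 1, sInf A + τ * (sSup A - sInf A) ∈ A := by
    intro A hA hA0 hAb
    have hbb := hAb.bddBelow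
    have hba := hAb.bddAbove
    have hle : sInf A ≤ sSup A :=
      hA0.elim fun x hx => (csInf_le hbb hx).trans (le_csSup hba hx)
    refine ⟨sub_nonneg.2 hle, ?_, fun τ hτ => ?_⟩
    · rw [← Real.volume_Icc]
      exact measure_mono (subset_Icc_csInf_csSup hbb hba)
    · rcases hle.lt_or_eq with h | h
      · obtain ⟨x, hx, hx'⟩ := exists_lt_of_csInf_lt hA0
          (show sInf A < sInf A + τ * (sSup A - sInf A) by nlinarith [hτ.1])
        obtain ⟨y, hy, hy'⟩ := exists_lt_of_lt_csSup hA0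
          (show sInf A + τ * (sSup A - sInf A) < sSup A by nlinarith [hτ.2])
        exact hA.out hx hy ⟨hx'.le, hy'.le⟩
      · obtain ⟨x, hx⟩ := hA0
        have h1 := csInf_le hbb hx
        have h2 := le_csSup hba hx
        have : sInf A + τ * (sSup A - sInf A) = x := by
          rw [← h, sub_self, mul_zero, add_zero]; linarith
        rwa [this]
  obtain ⟨a1, a2, a3⟩ := key hA hA0 hAb
  obtain ⟨b1, b2, b3⟩ := key hB hB0 hBb
  set lA := sSup A - sInf A
  set lB := sSup B - sInf B
  set z := a * sInf A + b * sInf B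
  calc ENNReal.ofReal a * volume A + ENNReal.ofReal b * volume B
      ≤ ENNReal.ofReal a * ENNReal.ofReal lA + ENNReal.ofReal b * ENNReal.ofReal lB := by gcongr
    _ = ENNReal.ofReal (z + (a * lA + b * lB) - z) := by
        rw [← ENNReal.ofReal_mul ha.le, ← ENNReal.ofReal_mul hb.le,
          ← ENNReal.ofReal_add (by positivity) (by positivity)]
        congr 1; ring
    _ = volume (Set.Ioo z (z + (a * lA + b * lB))) := by rw [Real.volume_Ioo]
    _ ≤ volume C := by
        refine measure_mono fun t ht => ?_
        have hl : 0 < a * lA + b * lB := by linarith [ht.1, ht.2]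
        -- The point `t` is the combination of the points of `A` and `B` at the same relative
        -- position `τ` in each interval.
        have hτ : (t - z) / (a * lA + b * lB) ∈ Set.Ioo (0 : ℝ) 1 := by
          constructor
          · exact div_pos (sub_pos.2 ht.1) hl
          · rw [div_lt_one hl]; linarith [ht.2]
        have := hC _ (a3 _ hτ) _ (b3 _ hτ)
        convert this using 1
        have h : t - z = (t - z) / (a * lA + b * lB) * (a * lA + b * lB) := by
          field_simp
        simp only [z] at h ⊢
        linear_combination h

/-- The normalized one-dimensional inequality behind Brunn's theorem. -/
theorem lintegral_combo_le {f₀ f₁ f : ℝ → ℝ} {a b R : ℝ} (ha : 0 < a) (hb : 0 < b)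
    (hm₀ : Measurable f₀) (hm₁ : Measurable f₁) (hm : Measurable f)
    (h₀ : ∀ s, 0 ≤ f₀ s) (h₁ : ∀ s, 0 ≤ f₁ s) (h : ∀ s, 0 ≤ f s)
    (hl₀ : ∀ s, f₀ s ≤ 1) (hl₁ : ∀ s, f₁ s ≤ 1)
    (hs₀ : ∀ w ∈ Set.Ioo (0 : ℝ) 1, ∃ s, w ≤ f₀ s) (hs₁ : ∀ w ∈ Set.Ioo (0 : ℝ) 1, ∃ s, w ≤ f₁ s)
    (hc₀ : ∀ w ∈ Set.Ioo (0 : ℝ) 1, {s | w ≤ f₀ s}.OrdConnected)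
    (hc₁ : ∀ w ∈ Set.Ioo (0 : ℝ) 1, {s | w ≤ f₁ s}.OrdConnected)
    (hb₀ : ∀ s, R < |s| → f₀ s = 0) (hb₁ : ∀ s, R < |s| → f₁ s = 0)
    (hf : ∀ w ∈ Set.Ioo (0 : ℝ) 1, ∀ s t, w ≤ f₀ s → w ≤ f₁ t → w ≤ f (a * s + b * t)) :
    ENNReal.ofReal a * (∫⁻ s, ENNReal.ofReal (f₀ s)) + ENNReal.ofReal b *
      (∫⁻ s, ENNReal.ofReal (f₁ s)) ≤ ∫⁻ s, ENNReal.ofReal (f s) := by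
  have hmeas : ∀ g : ℝ → ℝ, Measurable fun w : ℝ => volume {s | w ≤ g s} := fun g =>
    Antitone.measurable fun w w' hw => measure_mono fun s (hs : w' ≤ g s) => hw.trans hs
  have key : ∀ g : ℝ → ℝ, Measurable g → (∀ s, 0 ≤ g s) → (∀ s, g s ≤ 1) →
      ∫⁻ s, ENNReal.ofReal (g s) = ∫⁻ w in Set.Ioo (0 : ℝ) 1, volume {s | w ≤ g s} := by
    intro g hg hg0 hg1
    rw [lintegral_eq_lintegral_meas_le volume (Filter.Eventually.of_forall hg0) hg.aemeasurable,
      ← Set.Ioc_union_Ioi_eq_Ioi (zero_le_one' ℝ),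
      lintegral_union measurableSet_Ioi (Set.Ioc_disjoint_Ioi le_rfl)]
    have : ∫⁻ w in Set.Ioi (1 : ℝ), volume {s | w ≤ g s} = 0 := by
      rw [setLIntegral_congr_fun (g := fun _ => 0) measurableSet_Ioi]
      · simp
      · intro w hw
        have : {s | w ≤ g s} = ∅ := by
          ext s
          simp only [Set.mem_ofPred_eq, Set.mem_empty_iff_false, iff_false, not_le]
          exact (hg1 s).trans_lt hw
        simp [this]
    rw [this, add_zero, Measure.restrict_congr_set Ioo_ae_eq_Ioc]
  have hbdd : ∀ g : ℝ → ℝ, (∀ s, R < |s| → g s = 0) → ∀ w ∈ Set.Ioo (0 : ℝ) 1,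
      Bornology.IsBounded {s | w ≤ g s} := by
    intro g hg w hw
    refine (Metric.isBounded_Icc (-R) R).subset fun s (hs : w ≤ g s) => ?_
    rw [Set.mem_Icc, ← abs_le]
    by_contra hcon
    rw [hg s (not_le.1 hcon)] at hs
    linarith [hw.1]
  rw [key f₀ hm₀ h₀ hl₀, key f₁ hm₁ h₁ hl₁, ← lintegral_const_mul _ (hmeas f₀),
    ← lintegral_const_mul _ (hmeas f₁), ← lintegral_add_left ((hmeas f₀).const_mul _),
    lintegral_eq_lintegral_meas_le volume (Filter.Eventually.of_forall h) hm.aemeasurable]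
  -- Layer-cake formula, then Brunn-Minkowski at each level. Both level sets are non-empty for every
  -- `w < 1`; the levels of `f` above `1` are dropped.
  refine (setLIntegral_mono (hmeas f) fun w hw => ?_).trans
    (lintegral_mono_set Set.Ioo_subset_Ioi_self)
  exact volume_add_le_of_combo_mem ha hb (hc₀ w hw) (hc₁ w hw) (hs₀ w hw) (hs₁ w hw)
    (hbdd f₀ hb₀ w hw) (hbdd f₁ hb₁ w hw) fun s hs t ht => hf w hw s t hs ht

/-- Jensen's inequality for `x ^ (p + 1)` at `u / m₀` and `v / m₁`, with weights `a m₀ / m` and `b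
m₁ / m`. It removes the normalization by the suprema in the induction step of Brunn's theorem. -/
theorem pow_combo_le (p : ℕ) {a b u v m₀ m₁ : ℝ} (ha : 0 < a) (hb : 0 < b)
    (hu : 0 < u) (hv : 0 < v) (h₀ : 0 < m₀) (h₁ : 0 < m₁) :
    (a * u + b * v) ^ (p + 1) ≤
      (a * m₀ + b * m₁) ^ p * (a * (u ^ (p + 1) / m₀ ^ p) + b * (v ^ (p + 1) / m₁ ^ p)) := by
  set m := a * m₀ + b * m₁ with hm
  have hmp : 0 < m := by positivity
  have hconv := (convexOn_pow (𝕜 := ℝ) (p + 1)).2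
    (show u / m₀ ∈ Set.Ici (0 : ℝ) from (div_pos hu h₀).le)
    (show v / m₁ ∈ Set.Ici (0 : ℝ) from (div_pos hv h₁).le)
    (show 0 ≤ a * m₀ / m by positivity) (show 0 ≤ b * m₁ / m by positivity) (by
      rw [← add_div]; exact div_self hmp.ne')
  simp only [smul_eq_mul] at hconv
  have e1 : a * m₀ / m * (u / m₀) + b * m₁ / m * (v / m₁) = (a * u + b * v) / m := by
    field_simp
  have e2 : a * m₀ / m * (u / m₀) ^ (p + 1) + b * m₁ / m * (v / m₁) ^ (p + 1) =
      (a * (u ^ (p + 1) / m₀ ^ p) + b * (v ^ (p + 1) / m₁ ^ p)) / m := by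
    rw [div_pow, div_pow, pow_succ m₀, pow_succ m₁]
    field_simp
  rw [e1, e2, div_pow, div_le_div_iff₀ (by positivity) hmp] at hconv
  have : (a * u + b * v) ^ (p + 1) * m ≤
      (m ^ p * (a * (u ^ (p + 1) / m₀ ^ p) + b * (v ^ (p + 1) / m₁ ^ p))) * m := by
    refine hconv.trans (le_of_eq ?_)
    ring
  exact le_of_mul_le_mul_right this hmp

/-- Brunn's theorem, without roots: if the sections of a compact convex set have volume at least
`c u ^ m` over `x` and at least `c v ^ m` over `y`, then the section over `a x + b y` has volume at
least `c (a u + b v) ^ m`. -/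
theorem volume_section_combo (m : ℕ) : ∀ (E : Type) [NormedAddCommGroup E] [NormedSpace ℝ E]
    (S : Set (E × (Fin m → ℝ))), Convex ℝ S → IsCompact S →
    ∀ (x y : E) (a b c u v : ℝ), 0 < a → 0 < b → a + b = 1 → 0 < c → 0 < u → 0 < v →
    ENNReal.ofReal (c * u ^ m) ≤ volume {z | (x, z) ∈ S} →
    ENNReal.ofReal (c * v ^ m) ≤ volume {z | (y, z) ∈ S} →
    ENNReal.ofReal (c * (a * u + b * v) ^ m) ≤ volume {z | (a • x + b • y, z) ∈ S} := by
  induction m with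
  | zero =>
    intro E _ _ S hS _ x y a b c u v ha hb hab hc hu hv hx hy
    -- In dimension zero a section is empty or the whole one-point space, so positive volume means
    -- non-empty.
    have key : ∀ w : E, ENNReal.ofReal c ≤ volume {z | (w, z) ∈ S} → (w, 0) ∈ S := by
      intro w hw
      by_contra hcon
      have : {z : Fin 0 → ℝ | (w, z) ∈ S} = ∅ := by
        ext z
        rw [Subsingleton.elim z 0]
        simpa using hcon
      rw [this, measure_empty] at hw
      simp only [nonpos_iff_eq_zero, ENNReal.ofReal_eq_zero] at hw
      linarith
    simp only [pow_zero, mul_one] at hx hy ⊢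
    have h1 := hS (key x hx) (key y hy) ha.le hb.le hab
    have e1 : {z : Fin 0 → ℝ | (a • x + b • y, z) ∈ S} = Set.univ := by
      ext z
      rw [Subsingleton.elim z 0]
      simpa using h1
    rw [e1]
    exact hx.trans (measure_mono (Set.subset_univ _))
  | succ m ih =>
    intro E _ _ S hS hSc x y a b c u v ha hb hab hc hu hv hx hy
    -- One fibre coordinate is moved into the base, so that the induction hypothesis applies over `E
    -- × ℝ`. This is why `E` is arbitrary in the statement.
    let L : (E × ℝ) × (Fin m → ℝ) →ₗ[ℝ] E × (Fin (m + 1) → ℝ) :=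
      { toFun := fun w => (w.1.1, Fin.cons w.1.2 w.2)
        map_add' := fun w w' => by
          ext i
          · rfl
          · refine Fin.cases ?_ (fun j => ?_) i <;> simp
        map_smul' := fun r w => by
          ext i
          · rfl
          · refine Fin.cases ?_ (fun j => ?_) i <;> simp }
    set T : Set ((E × ℝ) × (Fin m → ℝ)) := L ⁻¹' S with hT
    have hTconv : Convex ℝ T := hS.linear_preimage L
    have hTim : T = (fun w : E × (Fin (m + 1) → ℝ) => ((w.1, w.2 0), Fin.tail w.2)) '' S := by
      ext w
      constructor
      · intro hw
        exact ⟨L w, hw, by simp [L]⟩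
      · rintro ⟨w', hw', rfl⟩
        simp only [hT, Set.mem_preimage, L, LinearMap.coe_mk, AddHom.coe_mk, Fin.cons_self_tail]
        exact hw'
    have hTc : IsCompact T := by
      rw [hTim]
      refine hSc.image ?_
      have : Continuous fun w : E × (Fin (m + 1) → ℝ) => Fin.tail w.2 :=
        continuous_pi fun i => (continuous_apply _).comp continuous_snd
      fun_prop
    have hTmeas : ∀ e : E, MeasurableSet {w : ℝ × (Fin m → ℝ) | ((e, w.1), w.2) ∈ T} := fun e =>
      (hTc.isClosed.preimage (by fun_prop)).measurableSet
    have hvol : ∀ e : E, volume {z | (e, z) ∈ S} = ∫⁻ s, volume {z | ((e, s), z) ∈ T} := by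
      intro e
      have h1 := (volume_preserving_piFinSuccAbove (fun _ : Fin (m + 1) => ℝ) 0).measure_preimage
        (hTmeas e).nullMeasurableSet
      have h2 : (MeasurableEquiv.piFinSuccAbove (fun _ : Fin (m + 1) => ℝ) 0) ⁻¹'
          {w : ℝ × (Fin m → ℝ) | ((e, w.1), w.2) ∈ T} = {z | (e, z) ∈ S} := by
        ext z
        simp only [Set.mem_preimage, Set.mem_ofPred_eq, hT, L, LinearMap.coe_mk, AddHom.coe_mk]
        have : (Fin.cons ((MeasurableEquiv.piFinSuccAbove (fun _ : Fin (m + 1) => ℝ) 0) z).1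
            ((MeasurableEquiv.piFinSuccAbove (fun _ : Fin (m + 1) => ℝ) 0) z).2
              : Fin (m + 1) → ℝ) = z := by
          ext i
          refine Fin.cases (by simp [MeasurableEquiv.piFinSuccAbove]) (fun j => ?_) i
          simp [MeasurableEquiv.piFinSuccAbove]
          rfl
        rw [this]
      rw [← h2, h1, Measure.volume_eq_prod, Measure.prod_apply (hTmeas e)]
      rfl
    have hfin : ∃ V : ℝ, 0 ≤ V ∧ ∀ w, volume {z | (w, z) ∈ T} ≤ ENNReal.ofReal V := by
      refine ⟨(volume (Prod.snd '' T)).toReal, ENNReal.toReal_nonneg, fun w => ?_⟩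
      rw [ENNReal.ofReal_toReal (hTc.image continuous_snd).measure_lt_top.ne]
      exact measure_mono fun z hz => ⟨_, hz, rfl⟩
    obtain ⟨V, hV0, hV⟩ := hfin
    obtain ⟨R, hR⟩ : ∃ R : ℝ, ∀ w ∈ T, |w.1.2| ≤ R := by
      have := (hTc.image (continuous_snd.comp continuous_fst)).isBounded
      obtain ⟨R, hR⟩ := this.exists_norm_le
      exact ⟨R, fun w hw => hR _ ⟨w, hw, rfl⟩⟩
    set F : E → ℝ → ℝ := fun e s => (volume {z | ((e, s), z) ∈ T}).toReal with hF
    have hF0 : ∀ e s, 0 ≤ F e s := fun e s => ENNReal.toReal_nonneg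
    have hFV : ∀ e s, ENNReal.ofReal (F e s) = volume {z | ((e, s), z) ∈ T} := fun e s =>
      ENNReal.ofReal_toReal ((hV _).trans_lt ENNReal.ofReal_lt_top).ne
    have hFle : ∀ e s, F e s ≤ V := fun e s => ENNReal.toReal_le_of_le_ofReal hV0 (hV _)
    have hFm : ∀ e, Measurable (F e) := fun e =>
      (measurable_measure_prodMk_left (hTmeas e)).ennreal_toReal
    have hFb : ∀ e s, R < |s| → F e s = 0 := by
      intro e s hs
      have : {z | ((e, s), z) ∈ T} = ∅ := by
        ext z
        simp only [Set.mem_ofPred_eq, Set.mem_empty_iff_false, iff_false]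
        intro hz
        exact absurd (hR _ hz) (not_le.2 hs)
      simp [hF, this]
    have hFc : ∀ (e e' : E) (s s' α β C p q : ℝ), 0 < α → 0 < β → α + β = 1 → 0 < C → 0 < p →
        0 < q → C * p ^ m ≤ F e s → C * q ^ m ≤ F e' s' →
        C * (α * p + β * q) ^ m ≤ F (α • e + β • e') (α * s + β * s') := by
      intro e e' s s' α β C p q hα hβ hαβ hC hp hq h1 h2
      have := ih (E × ℝ) T hTconv hTc (e, s) (e', s') α β C p q hα hβ hαβ hC hp hq
        (by rw [← hFV]; exact ENNReal.ofReal_le_ofReal h1)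
        (by rw [← hFV]; exact ENNReal.ofReal_le_ofReal h2)
      have h3 : α • (e, s) + β • (e', s') = (α • e + β • e', α * s + β * s') := by simp
      rw [h3, ← hFV] at this
      exact (ENNReal.ofReal_le_ofReal_iff (hF0 _ _)).1 this
    -- `M` is the `m`-th root of the supremum of `F e`. For `m = 0` there is no root to take, but
    -- then `F` only has the values 0 and 1.
    have hsup : ∀ e : E, (volume {z | (e, z) ∈ S} ≠ 0) → ∃ M > 0, (∀ s, F e s ≤ M ^ m) ∧
        ∀ w ∈ Set.Ioo (0 : ℝ) 1, ∃ s, w * M ^ m ≤ F e s := by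
      intro e he
      have hpos : ∃ s, 0 < F e s := by
        by_contra hcon
        push Not at hcon
        apply he
        rw [hvol]
        simp_rw [← hFV]
        simp [fun s => le_antisymm (hcon s) (hF0 e s)]
      obtain ⟨s₀, hs₀⟩ := hpos
      rcases Nat.eq_zero_or_pos m with hm | hm
      · subst hm
        have hone : ∀ s, 0 < F e s → F e s = 1 := by
          intro s hs
          have hne : {z | ((e, s), z) ∈ T} = Set.univ := by
            rw [Set.eq_univ_iff_forall]
            intro z
            by_contra hcon
            have : {z | ((e, s), z) ∈ T} = ∅ := by
              ext z'
              rw [Subsingleton.elim z' z]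
              simpa using hcon
            simp [hF, this] at hs
          simp [hF, hne, volume_pi]
        refine ⟨1, one_pos, fun s => ?_, fun w hw => ⟨s₀, ?_⟩⟩
        · rcases (hF0 e s).lt_or_eq with h | h
          · rw [hone s h]; simp
          · rw [← h]; simp
        · rw [hone s₀ hs₀]; simpa using hw.2.le
      · have hbdd : BddAbove (Set.range (F e)) := ⟨V, by rintro _ ⟨s, rfl⟩; exact hFle e s⟩
        have hMpos : 0 < ⨆ s, F e s := hs₀.trans_le (le_ciSup hbdd s₀)
        have hroot : ((⨆ s, F e s) ^ ((m : ℝ)⁻¹)) ^ m = ⨆ s, F e s :=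
          Real.rpow_inv_natCast_pow hMpos.le hm.ne'
        refine ⟨(⨆ s, F e s) ^ ((m : ℝ)⁻¹), Real.rpow_pos_of_pos hMpos _, fun s => ?_,
          fun w hw => ?_⟩
        · rw [hroot]; exact le_ciSup hbdd s
        · rw [hroot]
          obtain ⟨s, hs⟩ := exists_lt_of_lt_ciSup
            (show w * (⨆ s, F e s) < ⨆ s, F e s by nlinarith [hw.2])
          exact ⟨s, hs.le⟩
    have hne : ∀ {w : ℝ} {e : E}, 0 < w →
        ENNReal.ofReal (c * w ^ (m + 1)) ≤ volume {z | (e, z) ∈ S} →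
        volume {z | (e, z) ∈ S} ≠ 0 := by
      intro w e hw h
      have : 0 < ENNReal.ofReal (c * w ^ (m + 1)) := ENNReal.ofReal_pos.2 (by positivity)
      exact (this.trans_le h).ne'
    obtain ⟨M₀, hM₀, hM₀le, hM₀s⟩ := hsup x (hne hu hx)
    obtain ⟨M₁, hM₁, hM₁le, hM₁s⟩ := hsup y (hne hv hy)
    set M := a * M₀ + b * M₁ with hMdef
    have hM : 0 < M := by positivity
    have hord : ∀ (e : E) (N : ℝ), 0 < N → ∀ w ∈ Set.Ioo (0 : ℝ) 1,
        {s | w ≤ F e s / N ^ m}.OrdConnected := by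
      intro e N hN w hw
      refine Convex.ordConnected (𝕜 := ℝ) ?_
      rw [convex_iff_forall_pos]
      intro s hs t ht α β hα hβ hαβ
      simp only [Set.mem_ofPred_eq] at hs ht ⊢
      rw [le_div_iff₀ (by positivity)] at hs ht ⊢
      have := hFc e e s t α β w N N hα hβ hαβ hw.1 hN hN hs ht
      rwa [← add_mul, hαβ, one_mul, ← add_smul, hαβ, one_smul] at this
    -- After division by the suprema both functions have the levels `w ∈ (0, 1)` in common. By the
    -- induction hypothesis with `c = w`, levels `w M₀ ^ m` and `w M₁ ^ m` combine to `w M ^ m`.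
    have key := lintegral_combo_le (f₀ := fun s => F x s / M₀ ^ m) (f₁ := fun s => F y s / M₁ ^ m)
      (f := fun s => F (a • x + b • y) s / M ^ m) (R := R) ha hb
      ((hFm _).div_const _) ((hFm _).div_const _) ((hFm _).div_const _)
      (fun s => div_nonneg (hF0 _ _) (by positivity))
      (fun s => div_nonneg (hF0 _ _) (by positivity))
      (fun s => div_nonneg (hF0 _ _) (by positivity))
      (fun s => div_le_one_of_le₀ (hM₀le s) (by positivity))
      (fun s => div_le_one_of_le₀ (hM₁le s) (by positivity))
      (fun w hw => (hM₀s w hw).imp fun s hs => (le_div_iff₀ (by positivity)).2 hs)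
      (fun w hw => (hM₁s w hw).imp fun s hs => (le_div_iff₀ (by positivity)).2 hs)
      (hord x M₀ hM₀) (hord y M₁ hM₁)
      (fun s hs => by simp [hFb x s hs]) (fun s hs => by simp [hFb y s hs])
      (fun w hw s t hs ht => by
        rw [le_div_iff₀ (by positivity)] at hs ht ⊢
        exact hFc x y s t a b w M₀ M₁ ha hb hab hw.1 hM₀ hM₁ hs ht)
    have hdiv : ∀ (e : E) (N : ℝ), 0 < N → ∫⁻ s, ENNReal.ofReal (F e s / N ^ m) =
        ENNReal.ofReal ((N ^ m)⁻¹) * volume {z | (e, z) ∈ S} := by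
      intro e N hN
      have hms : Measurable fun s : ℝ => volume {z | ((e, s), z) ∈ T} :=
        measurable_measure_prodMk_left (hTmeas e)
      rw [hvol, ← lintegral_const_mul _ hms]
      refine lintegral_congr fun s => ?_
      rw [div_eq_inv_mul, ENNReal.ofReal_mul (by positivity)]
      exact congrArg _ (hFV e s)
    rw [hdiv x M₀ hM₀, hdiv y M₁ hM₁, hdiv _ M hM] at key
    have h1 : ENNReal.ofReal (a * (c * u ^ (m + 1) / M₀ ^ m) + b * (c * v ^ (m + 1) / M₁ ^ m)) ≤
        ENNReal.ofReal ((M ^ m)⁻¹) * volume {z | (a • x + b • y, z) ∈ S} := by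
      refine le_trans ?_ key
      have hdm : ∀ N w : ℝ, 0 < N → ENNReal.ofReal (c * w ^ (m + 1) / N ^ m) =
          ENNReal.ofReal ((N ^ m)⁻¹) * ENNReal.ofReal (c * w ^ (m + 1)) := fun N w hN => by
        rw [div_eq_inv_mul, ENNReal.ofReal_mul (by positivity)]
      rw [ENNReal.ofReal_add (by positivity) (by positivity), ENNReal.ofReal_mul ha.le,
        ENNReal.ofReal_mul hb.le, hdm _ _ hM₀, hdm _ _ hM₁]
      gcongr
    have h2 : ENNReal.ofReal (c * (a * u + b * v) ^ (m + 1)) ≤ ENNReal.ofReal (M ^ m) *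
        ENNReal.ofReal (a * (c * u ^ (m + 1) / M₀ ^ m) + b * (c * v ^ (m + 1) / M₁ ^ m)) := by
      rw [← ENNReal.ofReal_mul (by positivity)]
      refine ENNReal.ofReal_le_ofReal ?_
      have := mul_le_mul_of_nonneg_left (pow_combo_le m ha hb hu hv hM₀ hM₁) hc.le
      refine this.trans (le_of_eq ?_)
      ring
    refine h2.trans ((mul_le_mul_right h1 _).trans (le_of_eq ?_))
    rw [← mul_assoc, ← ENNReal.ofReal_mul (by positivity), mul_inv_cancel₀ (by positivity)]
    simp

/-! ### Densities of one-dimensional marginals. -/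

/-- Orthonormal coordinates whose first one is the direction `θ`. -/
theorem exists_slicing {p : ℕ} {θ : EuclideanSpace ℝ (Fin (p + 1))} (hθ : ‖θ‖ = 1) :
    ∃ Φ : EuclideanSpace ℝ (Fin (p + 1)) ≃ₗ[ℝ] ℝ × (Fin p → ℝ),
      MeasurePreserving Φ volume volume ∧ ∀ x, (Φ x).1 = inner ℝ x θ := by
  obtain ⟨b, hb⟩ := Orthonormal.exists_orthonormalBasis_extension_of_card_eq (𝕜 := ℝ)
    (ι := Fin (p + 1)) (E := EuclideanSpace ℝ (Fin (p + 1))) (by simp) (v := fun _ => θ)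
    (s := {0}) (by
      rw [orthonormal_iff_ite]
      rintro ⟨i, hi⟩ ⟨j, hj⟩
      simp only [Set.mem_singleton_iff] at hi hj
      subst hi hj
      simp [hθ])
  have hb0 : b 0 = θ := hb 0 rfl
  let Ψ : EuclideanSpace ℝ (Fin (p + 1)) ≃ₗ[ℝ] ℝ × (Fin p → ℝ) :=
    (b.repr.toLinearEquiv.trans (WithLp.linearEquiv 2 ℝ (Fin (p + 1) → ℝ))).trans
      (Fin.consLinearEquiv ℝ fun _ : Fin (p + 1) => ℝ).symm
  refine ⟨Ψ, ?_, fun x => ?_⟩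
  · have h1 := b.measurePreserving_repr
    have h2 := EuclideanSpace.volume_preserving_symm_measurableEquiv_toLp (Fin (p + 1))
    have h3 := volume_preserving_piFinSuccAbove (fun _ : Fin (p + 1) => ℝ) 0
    have h4 := (h3.comp h2).comp h1
    convert h4 using 1
    · rfl
    · rfl
  · have : (Ψ x).1 = b.repr x 0 := rfl
    rw [this, b.repr_apply_apply, hb0, real_inner_comm]

section
variable {p : ℕ} {θ : EuclideanSpace ℝ (Fin (p + 1))}
  {Φ : EuclideanSpace ℝ (Fin (p + 1)) ≃ₗ[ℝ] ℝ × (Fin p → ℝ)}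
  {K : Set (EuclideanSpace ℝ (Fin (p + 1)))}

/-- The density at `t` of the first coordinate of a random vector uniformly distributed on `K`. -/
noncomputable def sliceDensity (Φ : EuclideanSpace ℝ (Fin (p + 1)) ≃ₗ[ℝ] ℝ × (Fin p → ℝ))
    (K : Set (EuclideanSpace ℝ (Fin (p + 1)))) (t : ℝ) : ℝ :=
  (volume {y | Φ.symm (t, y) ∈ K}).toReal / (volume K).toReal

theorem IsConvexBody.measurableSet {n : ℕ} {K : Set (EuclideanSpace ℝ (Fin n))}
    (hK : IsConvexBody K) : MeasurableSet K := hK.2.1.measurableSet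

theorem IsConvexBody.volume_ne_top {n : ℕ} {K : Set (EuclideanSpace ℝ (Fin n))}
    (hK : IsConvexBody K) : volume K ≠ ⊤ := hK.2.1.measure_lt_top.ne

theorem IsConvexBody.volume_ne_zero {n : ℕ} {K : Set (EuclideanSpace ℝ (Fin n))}
    (hK : IsConvexBody K) : volume K ≠ 0 :=
  (Measure.measure_pos_of_nonempty_interior _ hK.2.2).ne'

theorem IsConvexBody.volume_toReal_pos {n : ℕ} {K : Set (EuclideanSpace ℝ (Fin n))}
    (hK : IsConvexBody K) : 0 < (volume K).toReal :=
  ENNReal.toReal_pos hK.volume_ne_zero hK.volume_ne_top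

theorem IsConvexBody.isProbabilityMeasure {n : ℕ} {K : Set (EuclideanSpace ℝ (Fin n))}
    (hK : IsConvexBody K) : IsProbabilityMeasure (uniformLaw K) :=
  cond_isProbabilityMeasure_of_finite hK.volume_ne_zero hK.volume_ne_top

theorem isCompact_slice (hK : IsConvexBody K) : IsCompact {w | Φ.symm w ∈ K} := by
  have : {w | Φ.symm w ∈ K} = Φ '' K := by
    ext w
    exact ⟨fun h => ⟨_, h, by simp⟩, by rintro ⟨x, hx, rfl⟩; simpa using hx⟩
  rw [this]
  exact hK.2.1.image Φ.toLinearMap.continuous_of_finiteDimensional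

theorem convex_slice (hK : IsConvexBody K) : Convex ℝ {w | Φ.symm w ∈ K} :=
  hK.1.linear_preimage Φ.symm.toLinearMap

theorem volume_section_ne_top (hK : IsConvexBody K) (t : ℝ) :
    volume {y | Φ.symm (t, y) ∈ K} ≠ ⊤ := by
  have h : IsCompact (Prod.snd '' {w | Φ.symm w ∈ K}) :=
    (isCompact_slice hK).image continuous_snd
  have hsub : {y | Φ.symm (t, y) ∈ K} ⊆ Prod.snd '' {w | Φ.symm w ∈ K} :=
    fun y hy => ⟨(t, y), hy, rfl⟩
  exact ((measure_mono hsub).trans_lt h.measure_lt_top).ne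

theorem sliceDensity_nonneg (t : ℝ) : 0 ≤ sliceDensity Φ K t :=
  div_nonneg ENNReal.toReal_nonneg ENNReal.toReal_nonneg

theorem measurable_sliceDensity (hK : IsConvexBody K) : Measurable (sliceDensity Φ K) :=
  ((measurable_measure_prodMk_left (ν := volume)
    (isCompact_slice (Φ := Φ) hK).measurableSet).ennreal_toReal).div_const _

theorem map_uniformLaw_eq_withDensity (hΦ : MeasurePreserving Φ volume volume)
    (hθ : ∀ x, (Φ x).1 = inner ℝ x θ) (hK : IsConvexBody K) :
    (uniformLaw K).map (fun x => inner ℝ x θ) =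
      volume.withDensity fun t => ENNReal.ofReal (sliceDensity Φ K t) := by
  have hS := (isCompact_slice (Φ := Φ) hK).measurableSet
  have hin : Measurable fun x : EuclideanSpace ℝ (Fin (p + 1)) => inner ℝ x θ :=
    (continuous_id.inner continuous_const).measurable
  ext A hA
  have hAS : MeasurableSet ({w : ℝ × (Fin p → ℝ) | Φ.symm w ∈ K} ∩ Prod.fst ⁻¹' A) :=
    hS.inter (measurable_fst hA)
  rw [Measure.map_apply hin hA, withDensity_apply _ hA, uniformLaw, cond_apply hK.measurableSet]
  have h1 : K ∩ (fun x => inner ℝ x θ) ⁻¹' A =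
      Φ ⁻¹' ({w : ℝ × (Fin p → ℝ) | Φ.symm w ∈ K} ∩ Prod.fst ⁻¹' A) := by
    ext x
    simp [hθ]
  rw [h1, hΦ.measure_preimage hAS.nullMeasurableSet, Measure.volume_eq_prod,
    Measure.prod_apply hAS, ← lintegral_indicator hA, ← lintegral_const_mul _
      (measurable_measure_prodMk_left hAS)]
  refine lintegral_congr fun t => ?_
  by_cases ht : t ∈ A
  · have : Prod.mk t ⁻¹' ({w : ℝ × (Fin p → ℝ) | Φ.symm w ∈ K} ∩ Prod.fst ⁻¹' A) =
        {y | Φ.symm (t, y) ∈ K} := by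
      ext y; simp [ht]
    rw [this, Set.indicator_of_mem ht, sliceDensity, div_eq_inv_mul,
      ENNReal.ofReal_mul (by positivity), ENNReal.ofReal_toReal (volume_section_ne_top hK t),
      ENNReal.ofReal_inv_of_pos hK.volume_toReal_pos, ENNReal.ofReal_toReal hK.volume_ne_top]
  · have : Prod.mk t ⁻¹' ({w : ℝ × (Fin p → ℝ) | Φ.symm w ∈ K} ∩ Prod.fst ⁻¹' A) = ∅ := by
      ext y; simp [ht]
    rw [this, Set.indicator_of_notMem ht]
    simp

theorem sliceDensity_eq_zero (hθ : ∀ x, (Φ x).1 = inner ℝ x θ) {t : ℝ}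
    (ht : ∀ x ∈ K, inner ℝ x θ ≠ t) : sliceDensity Φ K t = 0 := by
  have : {y | Φ.symm (t, y) ∈ K} = ∅ := by
    ext y
    simp only [Set.mem_ofPred_eq, Set.mem_empty_iff_false, iff_false]
    intro hy
    refine ht _ hy ?_
    rw [← hθ]; simp
  simp [sliceDensity, this]

theorem integrableBddSupport_sliceDensity (hΦ : MeasurePreserving Φ volume volume)
    (hθ : ∀ x, (Φ x).1 = inner ℝ x θ) (hK : IsConvexBody K) :
    IntegrableBddSupport (sliceDensity Φ K) := by
  constructor
  · have := hK.isProbabilityMeasure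
    have hin : Measurable fun x : EuclideanSpace ℝ (Fin (p + 1)) => inner ℝ x θ :=
      (continuous_id.inner continuous_const).measurable
    have h1 : IsProbabilityMeasure ((uniformLaw K).map (fun x => inner ℝ x θ)) :=
      Measure.isProbabilityMeasure_map hin.aemeasurable
    refine ⟨(measurable_sliceDensity hK).aestronglyMeasurable, ?_⟩
    rw [hasFiniteIntegral_iff_ofReal (Filter.Eventually.of_forall sliceDensity_nonneg)]
    have h2 := h1.measure_univ
    rw [map_uniformLaw_eq_withDensity hΦ hθ hK, withDensity_apply _ MeasurableSet.univ,
      Measure.restrict_univ] at h2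
    rw [h2]
    exact ENNReal.one_lt_top
  · have hc : IsCompact ((fun x => inner ℝ x θ) '' K) :=
      hK.2.1.image (continuous_id.inner continuous_const)
    obtain ⟨R, hR⟩ := hc.isBounded.exists_norm_le
    refine ⟨R, fun t ht => sliceDensity_eq_zero hθ fun x hx hxt => ?_⟩
    have := hR _ ⟨x, hx, rfl⟩
    simp only [Real.norm_eq_abs, hxt] at this
    linarith

theorem integral_uniformLaw_inner (hΦ : MeasurePreserving Φ volume volume)
    (hθ : ∀ x, (Φ x).1 = inner ℝ x θ) (hK : IsConvexBody K) {ψ : ℝ → ℝ} (hψ : Continuous ψ) :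
    ∫ x, ψ (inner ℝ x θ) ∂(uniformLaw K) = ∫ t, sliceDensity Φ K t * ψ t := by
  have hin : Measurable fun x : EuclideanSpace ℝ (Fin (p + 1)) => inner ℝ x θ :=
    (continuous_id.inner continuous_const).measurable
  rw [← integral_map hin.aemeasurable hψ.aestronglyMeasurable,
    map_uniformLaw_eq_withDensity hΦ hθ hK,
    integral_withDensity_eq_integral_toReal_smul
      (measurable_sliceDensity hK).ennreal_ofReal (by simp)]
  refine integral_congr_ae (Filter.Eventually.of_forall fun t => ?_)
  simp [ENNReal.toReal_ofReal (sliceDensity_nonneg t)]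

theorem sliceDensity_combo (hK : IsConvexBody K) {s t a b c u v : ℝ} (ha : 0 < a) (hb : 0 < b)
    (hab : a + b = 1) (hc : 0 < c) (hu : 0 < u) (hv : 0 < v)
    (hs : c * u ^ p ≤ sliceDensity Φ K s) (ht : c * v ^ p ≤ sliceDensity Φ K t) :
    c * (a * u + b * v) ^ p ≤ sliceDensity Φ K (a * s + b * t) := by
  have hV := hK.volume_toReal_pos
  unfold sliceDensity at *
  rw [le_div_iff₀ hV] at *
  have := volume_section_combo p ℝ {w | Φ.symm w ∈ K} (convex_slice hK) (isCompact_slice hK)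
    s t a b (c * (volume K).toReal) u v ha hb hab (by positivity) hu hv
    (by
      rw [← ENNReal.ofReal_toReal (a := volume {z | (s, z) ∈ {w | Φ.symm w ∈ K}})
        (volume_section_ne_top hK s)]
      refine ENNReal.ofReal_le_ofReal (le_trans (le_of_eq ?_) hs); ring)
    (by
      rw [← ENNReal.ofReal_toReal (a := volume {z | (t, z) ∈ {w | Φ.symm w ∈ K}})
        (volume_section_ne_top hK t)]
      refine ENNReal.ofReal_le_ofReal (le_trans (le_of_eq ?_) ht); ring)
  have h2 := (ENNReal.ofReal_le_iff_le_toReal (volume_section_ne_top hK (a * s + b * t))).1 this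
  refine le_trans (le_of_eq ?_) h2
  ring

open scoped Pointwise in
theorem volume_affine_image (r : ℝ) (hr : 0 ≤ r) (z : Fin p → ℝ) (A : Set (Fin p → ℝ)) :
    volume ((fun y => z + r • y) '' A) = ENNReal.ofReal (r ^ p) * volume A := by
  have : (fun y => z + r • y) '' A = z +ᵥ (r • A) := by
    rw [← Set.image_smul, ← Set.image_vadd, Set.image_image]
    rfl
  rw [this, measure_vadd, Measure.addHaar_smul_of_nonneg _ hr]
  simp

/-- The homothety with centre `q` and ratio `r` maps the section at `t` into `K` and scales its
volume by `r ^ p`. This is the limit case `u = 0` which `sliceDensity_combo` excludes. -/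
theorem sliceDensity_homothety_le (hθ : ∀ x, (Φ x).1 = inner ℝ x θ) (hK : IsConvexBody K)
    {q : EuclideanSpace ℝ (Fin (p + 1))} (hq : q ∈ K) {a r : ℝ} (ha : 0 ≤ a) (hr : 0 ≤ r)
    (har : a + r = 1) (t : ℝ) :
    r ^ p * sliceDensity Φ K t ≤ sliceDensity Φ K (a * inner ℝ q θ + r * t) := by
  have hV := hK.volume_toReal_pos
  unfold sliceDensity
  rw [← mul_div_assoc]
  refine div_le_div_of_nonneg_right ?_ hV.le
  rw [← ENNReal.toReal_ofReal (pow_nonneg hr p), ← ENNReal.toReal_mul,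
    ← volume_affine_image r hr (a • (Φ q).2)]
  refine ENNReal.toReal_mono (volume_section_ne_top hK _) (measure_mono ?_)
  rintro _ ⟨y, hy, rfl⟩
  have h := hK.1 hq hy ha hr har
  simp only [Set.mem_ofPred_eq]
  convert h using 1
  apply Φ.injective
  rw [map_add, map_smul, map_smul]
  ext
  · simp [hθ]
  · simp

theorem exists_mem_of_sliceDensity_pos (hθ : ∀ x, (Φ x).1 = inner ℝ x θ) {t : ℝ}
    (ht : 0 < sliceDensity Φ K t) : ∃ x ∈ K, inner ℝ x θ = t := by
  by_contra hcon
  push Not at hcon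
  rw [sliceDensity_eq_zero hθ hcon] at ht
  exact lt_irrefl _ ht

/-- The density of the sections along a part of `K` that is a cone with apex `q`. -/
theorem sliceDensity_eq_of_homothety (hθ : ∀ x, (Φ x).1 = inner ℝ x θ) (hK : IsConvexBody K)
    {q : EuclideanSpace ℝ (Fin (p + 1))} (hq : q ∈ K) {r b t : ℝ} (hr : 0 < r) (hr1 : r ≤ 1)
    (ht : t = inner ℝ q θ + r * (b - inner ℝ q θ))
    (hK' : ∀ x ∈ K, inner ℝ x θ = t → q + r⁻¹ • (x - q) ∈ K) :
    sliceDensity Φ K t = r ^ p * sliceDensity Φ K b := by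
  -- For `≤`, expanding the section at `t` from `q` lands in the section at `b`, by `hK'`. For `≥`,
  -- contract by convexity.
  refine le_antisymm ?_ ?_
  · have hV := hK.volume_toReal_pos
    unfold sliceDensity
    rw [← mul_div_assoc]
    refine div_le_div_of_nonneg_right ?_ hV.le
    rw [← ENNReal.toReal_ofReal (pow_nonneg hr.le p), ← ENNReal.toReal_mul,
      ← volume_affine_image r hr.le ((1 - r) • (Φ q).2)]
    refine ENNReal.toReal_mono ?_ (measure_mono ?_)
    · rw [volume_affine_image r hr.le]
      exact ENNReal.mul_ne_top ENNReal.ofReal_ne_top (volume_section_ne_top hK _)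
    intro y hy
    have h := hK' _ hy (by rw [← hθ]; simp)
    refine ⟨(Φ (q + r⁻¹ • (Φ.symm (t, y) - q))).2, ?_, ?_⟩
    · have : (b, (Φ (q + r⁻¹ • (Φ.symm (t, y) - q))).2) = Φ (q + r⁻¹ • (Φ.symm (t, y) - q)) := by
        ext
        · simp only [map_add, map_smul, map_sub, LinearEquiv.apply_symm_apply, Prod.fst_add,
            Prod.smul_fst, Prod.fst_sub, hθ, ht, smul_eq_mul]
          field_simp
          ring
        · rfl
      simp only [Set.mem_ofPred_eq]
      rw [this, LinearEquiv.symm_apply_apply]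
      exact h
    · ext i
      simp
      field_simp
      ring
  · have := sliceDensity_homothety_le (Φ := Φ) hθ hK hq (a := 1 - r) (by linarith) hr.le
      (by ring) b
    have e : (1 - r) * inner ℝ q θ + r * b = t := by rw [ht]; ring
    rwa [e] at this

end

/-! ### Concave densities, tents and the sets where one exceeds the other. -/

/-- `f ^ (1 / p)` is concave on the support of `f`, written without roots. -/
structure PowConcave (p : ℕ) (f : ℝ → ℝ) : Prop where
  nonneg : ∀ t, 0 ≤ f t
  combo : ∀ {s t a b c u v : ℝ}, 0 < a → 0 < b → a + b = 1 → 0 < c → 0 < u → 0 < v →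
    c * u ^ p ≤ f s → c * v ^ p ≤ f t → c * (a * u + b * v) ^ p ≤ f (a * s + b * t)
  homothety : ∀ {s t a r : ℝ}, 0 ≤ a → 0 ≤ r → a + r = 1 → 0 < f s →
    r ^ p * f t ≤ f (a * s + r * t)

/-- A density on `[a, d]`, a multiple of the `p`-th power of an affine function vanishing at `a`
on `(a, b)` and of one vanishing at `d` on `(b, d)`. -/
structure TentDensity (p : ℕ) (g : ℝ → ℝ) (a b d c : ℝ) : Prop where
  le_left : a ≤ b
  le_right : b ≤ d
  nonneg : 0 ≤ c
  lt_eq_zero : ∀ t < a, g t = 0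
  gt_eq_zero : ∀ t, d < t → g t = 0
  left : ∀ t ∈ Set.Ioo a b, g t = c * ((t - a) / (b - a)) ^ p
  right : ∀ t ∈ Set.Ioo b d, g t = c * ((d - t) / (d - b)) ^ p

/-- The endpoints serve as sign-change points; membership at them is left open, which is harmless
almost everywhere. An empty `P` gives a degenerate interval, hence a repeated node. -/
theorem exists_Ioo_of_ordConnected {P : Set ℝ} {l r : ℝ} (hlr : l ≤ r) (hP : P ⊆ Set.Ioo l r)
    (hc : P.OrdConnected) : ∃ x y, l ≤ x ∧ x ≤ y ∧ y ≤ r ∧ Set.Ioo x y ⊆ P ∧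
      ∀ t, t < x ∨ y < t → t ∉ P := by
  rcases P.eq_empty_or_nonempty with rfl | hne
  · exact ⟨l, l, le_rfl, le_rfl, hlr, by simp, by simp⟩
  · have hb : BddBelow P := ⟨l, fun x hx => (hP hx).1.le⟩
    have ha : BddAbove P := ⟨r, fun x hx => (hP hx).2.le⟩
    refine ⟨sInf P, sSup P, le_csInf hne fun x hx => (hP hx).1.le,
      hne.elim fun x hx => (csInf_le hb hx).trans (le_csSup ha hx),
      csSup_le hne fun x hx => (hP hx).2.le, fun t ht => ?_, fun t ht htP => ?_⟩
    · obtain ⟨x, hx, hxt⟩ := exists_lt_of_csInf_lt hne ht.1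
      obtain ⟨y, hy, hyt⟩ := exists_lt_of_lt_csSup hne ht.2
      exact hc.out hx hy ⟨hxt.le, hyt.le⟩
    · have h1 := csInf_le hb htP
      have h2 := le_csSup ha htP
      rcases ht with h | h <;> linarith

theorem exists_Ioo_of_initial {P : Set ℝ} {l r : ℝ} (hlr : l ≤ r) (hP : P ⊆ Set.Ioo l r)
    (hi : ∀ t ∈ P, Set.Ioo l t ⊆ P) : ∃ y, l ≤ y ∧ y ≤ r ∧ Set.Ioo l y ⊆ P ∧
      ∀ t, y < t → t ∉ P := by
  rcases P.eq_empty_or_nonempty with rfl | hne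
  · exact ⟨l, le_rfl, hlr, by simp, by simp⟩
  · have ha : BddAbove P := ⟨r, fun x hx => (hP hx).2.le⟩
    refine ⟨sSup P, hne.elim fun x hx => (hP hx).1.le.trans (le_csSup ha hx),
      csSup_le hne fun x hx => (hP hx).2.le, fun t ht => ?_, fun t ht htP => ?_⟩
    · obtain ⟨y, hy, hyt⟩ := exists_lt_of_lt_csSup hne ht.2
      exact hi y hy ⟨ht.1, hyt⟩
    · exact absurd (le_csSup ha htP) (not_le.2 ht)

theorem exists_Ioo_of_final {P : Set ℝ} {l r : ℝ} (hlr : l ≤ r) (hP : P ⊆ Set.Ioo l r)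
    (hi : ∀ t ∈ P, Set.Ioo t r ⊆ P) : ∃ x, l ≤ x ∧ x ≤ r ∧ Set.Ioo x r ⊆ P ∧
      ∀ t, t < x → t ∉ P := by
  rcases P.eq_empty_or_nonempty with rfl | hne
  · exact ⟨r, hlr, le_rfl, by simp, by simp⟩
  · have hb : BddBelow P := ⟨l, fun x hx => (hP hx).1.le⟩
    refine ⟨sInf P, le_csInf hne fun x hx => (hP hx).1.le,
      hne.elim fun x hx => (csInf_le hb hx).trans (hP hx).2.le, fun t ht => ?_, fun t ht htP => ?_⟩
    · obtain ⟨x, hx, hxt⟩ := exists_lt_of_csInf_lt hne ht.1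
      exact hi x hx ⟨hxt, ht.2⟩
    · exact absurd (csInf_le hb htP) (not_le.2 ht)

section
variable {p : ℕ} {f g : ℝ → ℝ} {a b d c : ℝ}

/-- On `(a, b)` the root of `g` is affine, and a concave function lies above an affine one on an
interval. -/
theorem TentDensity.ordConnected_left (hf : PowConcave p f) (hg : TentDensity p g a b d c) :
    {t | t ∈ Set.Ioo a b ∧ g t ≤ f t}.OrdConnected := by
  refine Convex.ordConnected (𝕜 := ℝ) ?_
  rw [convex_iff_forall_pos]
  rintro s ⟨hs, hsf⟩ t ⟨ht, htf⟩ α β hα hβ hαβ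
  have hm : α * s + β * t ∈ Set.Ioo a b := convex_Ioo a b hs ht hα.le hβ.le hαβ
  refine ⟨hm, ?_⟩
  simp only [smul_eq_mul]
  rw [hg.left _ hs] at hsf
  rw [hg.left _ ht] at htf
  rw [hg.left _ hm]
  rcases hg.nonneg.eq_or_lt with h0 | h0
  · rw [← h0, zero_mul]; exact hf.nonneg _
  · have hba : 0 < b - a := by linarith [hs.1, hs.2]
    have := hf.combo hα hβ hαβ h0 (div_pos (sub_pos.2 hs.1) hba) (div_pos (sub_pos.2 ht.1) hba)
      hsf htf
    convert this using 3
    field_simp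
    linear_combination a * hαβ

theorem TentDensity.ordConnected_right (hf : PowConcave p f) (hg : TentDensity p g a b d c) :
    {t | t ∈ Set.Ioo b d ∧ g t ≤ f t}.OrdConnected := by
  refine Convex.ordConnected (𝕜 := ℝ) ?_
  rw [convex_iff_forall_pos]
  rintro s ⟨hs, hsf⟩ t ⟨ht, htf⟩ α β hα hβ hαβ
  have hm : α * s + β * t ∈ Set.Ioo b d := convex_Ioo b d hs ht hα.le hβ.le hαβ
  refine ⟨hm, ?_⟩
  simp only [smul_eq_mul]
  rw [hg.right _ hs] at hsf
  rw [hg.right _ ht] at htf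
  rw [hg.right _ hm]
  rcases hg.nonneg.eq_or_lt with h0 | h0
  · rw [← h0, zero_mul]; exact hf.nonneg _
  · have hba : 0 < d - b := by linarith [hs.1, hs.2]
    have := hf.combo hα hβ hαβ h0 (div_pos (sub_pos.2 hs.2) hba) (div_pos (sub_pos.2 ht.2) hba)
      hsf htf
    convert this using 3
    field_simp
    linear_combination (-d) * hαβ

/-- Let `f s > 0` at some `s < a`. Between `s` and `t` the root of `f` lies above the affine
function that vanishes at `s` and equals that root at `t`. The root of `g` already vanishes at `a >
s`, so if it is below at `t` it stays below on `(a, t)`. -/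
theorem TentDensity.initial_left (hf : PowConcave p f) (hg : TentDensity p g a b d c) {s : ℝ}
    (hs : s < a) (hfs : 0 < f s) : ∀ t ∈ {t | t ∈ Set.Ioo a b ∧ g t ≤ f t},
      Set.Ioo a t ⊆ {t | t ∈ Set.Ioo a b ∧ g t ≤ f t} := by
  rintro t ⟨ht, htf⟩ r hr
  have hrm : r ∈ Set.Ioo a b := ⟨hr.1, hr.2.trans ht.2⟩
  refine ⟨hrm, ?_⟩
  have hba : 0 < b - a := by linarith [ht.1, ht.2]
  have hts : 0 < t - s := by linarith [ht.1]
  have hrs : 0 < r - s := by linarith [hr.1]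
  have har : 0 < r - a := by linarith [hr.1]
  have hat : 0 < t - a := by linarith [ht.1]
  have h1 := hf.homothety (s := s) (t := t) (a := 1 - (r - s) / (t - s)) (r := (r - s) / (t - s))
    (by rw [sub_nonneg, div_le_one hts]; linarith [hr.2]) (by positivity) (by ring) hfs
  have e : (1 - (r - s) / (t - s)) * s + (r - s) / (t - s) * t = r := by field_simp; ring
  rw [e] at h1
  rw [hg.left _ ht] at htf
  rw [hg.left _ hrm]
  refine le_trans ?_ (le_trans (mul_le_mul_of_nonneg_left htf (by positivity)) h1)
  have h2 : (r - a) / (b - a) ≤ (r - s) / (t - s) * ((t - a) / (b - a)) := by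
    rw [← mul_div_assoc]
    refine div_le_div_of_nonneg_right ?_ hba.le
    rw [div_mul_eq_mul_div, le_div_iff₀ hts]
    nlinarith [hr.2]
  have h3 := pow_le_pow_left₀ (by positivity) h2 p
  rw [mul_pow] at h3
  have := mul_le_mul_of_nonneg_left h3 hg.nonneg
  linarith

theorem TentDensity.final_right (hf : PowConcave p f) (hg : TentDensity p g a b d c) {s : ℝ}
    (hs : d < s) (hfs : 0 < f s) : ∀ t ∈ {t | t ∈ Set.Ioo b d ∧ g t ≤ f t},
      Set.Ioo t d ⊆ {t | t ∈ Set.Ioo b d ∧ g t ≤ f t} := by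
  rintro t ⟨ht, htf⟩ r hr
  have hrm : r ∈ Set.Ioo b d := ⟨ht.1.trans hr.1, hr.2⟩
  refine ⟨hrm, ?_⟩
  have hba : 0 < d - b := by linarith [ht.1, ht.2]
  have hts : 0 < s - t := by linarith [ht.2]
  have hrs : 0 < s - r := by linarith [hr.2]
  have har : 0 < d - r := by linarith [hr.2]
  have hat : 0 < d - t := by linarith [ht.2]
  have h1 := hf.homothety (s := s) (t := t) (a := 1 - (s - r) / (s - t)) (r := (s - r) / (s - t))
    (by rw [sub_nonneg, div_le_one hts]; linarith [hr.1]) (by positivity) (by ring) hfs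
  have e : (1 - (s - r) / (s - t)) * s + (s - r) / (s - t) * t = r := by field_simp; ring
  rw [e] at h1
  rw [hg.right _ ht] at htf
  rw [hg.right _ hrm]
  refine le_trans ?_ (le_trans (mul_le_mul_of_nonneg_left htf (by positivity)) h1)
  have h2 : (d - r) / (d - b) ≤ (s - r) / (s - t) * ((d - t) / (d - b)) := by
    rw [← mul_div_assoc]
    refine div_le_div_of_nonneg_right ?_ hba.le
    rw [div_mul_eq_mul_div, le_div_iff₀ hts]
    nlinarith [hr.1]
  have h3 := pow_le_pow_left₀ (by positivity) h2 p
  rw [mul_pow] at h3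
  have := mul_le_mul_of_nonneg_left h3 hg.nonneg
  linarith

end

theorem mul_prod_nonpos_of_two_sign_changes {D t x y : ℝ} (hxy : x ≤ y) (h1 : t < x → D ≤ 0)
    (h2 : x < t → t < y → 0 ≤ D) (h3 : y < t → D ≤ 0) : D * ([x, y].map fun z => t - z).prod ≤ 0 := by
  simp only [List.map_cons, List.map_nil, List.prod_cons, List.prod_nil, mul_one]
  rcases lt_trichotomy t x with h | h | h
  · exact mul_nonpos_of_nonpos_of_nonneg (h1 h) (mul_nonneg_of_nonpos_of_nonpos
      (by linarith) (by linarith))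
  · simp [h]
  rcases lt_trichotomy t y with h' | h' | h'
  · exact mul_nonpos_of_nonneg_of_nonpos (h2 h h') (mul_nonpos_of_nonneg_of_nonpos
      (by linarith) (by linarith))
  · simp [h']
  · exact mul_nonpos_of_nonpos_of_nonneg (h3 h') (mul_nonneg (by linarith) (by linarith))

theorem mul_prod_nonpos_of_three_sign_changes {D t x y z : ℝ} (hxy : x ≤ y) (hyz : y ≤ z)
    (h1 : t < x → 0 ≤ D) (h2 : x < t → t < y → D ≤ 0) (h3 : y < t → t < z → 0 ≤ D)
    (h4 : z < t → D ≤ 0) : D * ([x, y, z].map fun w => t - w).prod ≤ 0 := by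
  have e : D * ([x, y, z].map fun w => t - w).prod =
      (D * (t - x)) * ([y, z].map fun w => t - w).prod := by
    simp only [List.map_cons, List.prod_cons]; ring
  rw [e]
  refine mul_prod_nonpos_of_two_sign_changes hyz (fun h => ?_) (fun h h' => ?_) (fun h => ?_)
  · rcases lt_trichotomy t x with h' | h' | h'
    · exact mul_nonpos_of_nonneg_of_nonpos (h1 h') (by linarith)
    · simp [h']
    · exact mul_nonpos_of_nonpos_of_nonneg (h2 h' h) (by linarith)
  · exact mul_nonneg (h3 h h') (by linarith)
  · exact mul_nonpos_of_nonpos_of_nonneg (h4 h) (by linarith)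

theorem mul_prod_nonpos_of_four_sign_changes {D t w x y z : ℝ} (hwx : w ≤ x) (hxy : x ≤ y)
    (hyz : y ≤ z) (h0 : t < w → D ≤ 0)
    (h1 : w < t → t < x → 0 ≤ D) (h2 : x < t → t < y → D ≤ 0) (h3 : y < t → t < z → 0 ≤ D)
    (h4 : z < t → D ≤ 0) : D * ([w, x, y, z].map fun w => t - w).prod ≤ 0 := by
  have e : D * ([w, x, y, z].map fun w => t - w).prod =
      (D * (t - w)) * ([x, y, z].map fun w => t - w).prod := by
    simp only [List.map_cons, List.prod_cons]; ring
  rw [e]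
  refine mul_prod_nonpos_of_three_sign_changes hxy hyz (fun h => ?_) (fun h h' => ?_)
    (fun h h' => ?_) (fun h => ?_)
  · rcases lt_trichotomy t w with h' | h' | h'
    · exact mul_nonneg_of_nonpos_of_nonpos (h0 h') (by linarith)
    · simp [h']
    · exact mul_nonneg (h1 h' h) (by linarith)
  · exact mul_nonpos_of_nonpos_of_nonneg (h2 h h') (by linarith)
  · exact mul_nonneg (h3 h h') (by linarith)
  · exact mul_nonpos_of_nonpos_of_nonneg (h4 h) (by linarith)

/-! ### Counting sign changes and comparing integrals. -/

section
variable {p : ℕ} {f g : ℝ → ℝ} {a b d c : ℝ}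

/-- The sign changes of `f - g` when `g` is supported on an interval on which `g ^ (1 / p)` is
affine and vanishes at the right end. -/
theorem TentDensity.sign_changes_cone (hf : PowConcave p f) (hg : TentDensity p g a a d c) :
    (∃ L : List ℝ, L.length = 3 ∧ ∀ᵐ t, (f t - g t) * (L.map fun x => t - x).prod ≤ 0) ∨
    ∃ L : List ℝ, L.length = 2 ∧ ∀ᵐ t, -(f t - g t) * (L.map fun x => t - x).prod ≤ 0 := by
  have hsub : {t | t ∈ Set.Ioo a d ∧ g t ≤ f t} ⊆ Set.Ioo a d := fun t ht => ht.1
  have hlt : ∀ t < a, 0 ≤ f t - g t := fun t ht => by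
    rw [hg.lt_eq_zero t ht, sub_zero]; exact hf.nonneg t
  have hgt : ∀ t, d < t → 0 ≤ f t - g t := fun t ht => by
    rw [hg.gt_eq_zero t ht, sub_zero]; exact hf.nonneg t
  -- If `f` has mass beyond `d`, the signs of `f - g` are `+ - +`, two changes only. Otherwise they
  -- are `+ - + -`.
  by_cases hex : ∃ s, d < s ∧ 0 < f s
  · obtain ⟨s, hs, hfs⟩ := hex
    obtain ⟨x, hx1, hx2, hx3, hx4⟩ := exists_Ioo_of_final hg.le_right hsub
      (hg.final_right hf hs hfs)
    refine Or.inr ⟨[a, x], rfl, ?_⟩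
    filter_upwards [ae_notMem_list [a, d]] with t ht
    simp only [List.mem_cons, List.not_mem_nil, or_false, not_or] at ht
    refine mul_prod_nonpos_of_two_sign_changes hx1 (fun h => ?_) (fun h h' => ?_) (fun h => ?_)
    · linarith [hlt t h]
    · have := hx4 t h'
      simp only [Set.mem_ofPred_eq, not_and, not_le] at this
      linarith [this ⟨h, by linarith⟩]
    · rcases lt_or_gt_of_ne ht.2 with h' | h'
      · linarith [(hx3 ⟨h, h'⟩).2]
      · linarith [hgt t h']
  · push Not at hex
    obtain ⟨x, y, hx1, hx2, hx3, hx4, hx5⟩ := exists_Ioo_of_ordConnected hg.le_right hsub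
      (hg.ordConnected_right hf)
    refine Or.inl ⟨[a, x, y], rfl, ?_⟩
    filter_upwards [ae_notMem_list [a, d]] with t ht
    simp only [List.mem_cons, List.not_mem_nil, or_false, not_or] at ht
    refine mul_prod_nonpos_of_three_sign_changes hx1 hx2 (hlt t) (fun h h' => ?_) (fun h h' => ?_)
      (fun h => ?_)
    · have := hx5 t (Or.inl h')
      simp only [Set.mem_ofPred_eq, not_and, not_le] at this
      linarith [this ⟨h, by linarith⟩]
    · linarith [(hx4 ⟨h, h'⟩).2]
    · rcases lt_or_gt_of_ne ht.2 with h' | h'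
      · have := hx5 t (Or.inr h)
        simp only [Set.mem_ofPred_eq, not_and, not_le] at this
        linarith [this ⟨by linarith, h'⟩]
      · rw [hg.gt_eq_zero t h', sub_zero]; exact hex t h'

/-- The sign changes of `f - g` when `g ^ (1 / p)` is a tent. -/
theorem TentDensity.sign_changes (hf : PowConcave p f) (hg : TentDensity p g a b d c) :
    (∃ L : List ℝ, L.length = 4 ∧ ∀ᵐ t, (f t - g t) * (L.map fun x => t - x).prod ≤ 0) ∨
    (∃ L : List ℝ, L.length ≤ 3 ∧ ∀ᵐ t, (f t - g t) * (L.map fun x => t - x).prod ≤ 0) ∨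
    ∃ L : List ℝ, L.length ≤ 3 ∧ ∀ᵐ t, -(f t - g t) * (L.map fun x => t - x).prod ≤ 0 := by
  have hsub : {t | t ∈ Set.Ioo b d ∧ g t ≤ f t} ⊆ Set.Ioo b d := fun t ht => ht.1
  have hsub' : {t | t ∈ Set.Ioo a b ∧ g t ≤ f t} ⊆ Set.Ioo a b := fun t ht => ht.1
  have hlt : ∀ t < a, 0 ≤ f t - g t := fun t ht => by
    rw [hg.lt_eq_zero t ht, sub_zero]; exact hf.nonneg t
  have hgt : ∀ t, d < t → 0 ≤ f t - g t := fun t ht => by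
    rw [hg.gt_eq_zero t ht, sub_zero]; exact hf.nonneg t
  -- To the left of the peak `b` the signs of `f - g` are `+ -` if `f` has mass below `a`, and `- +
  -- -` otherwise. To the right they are `- +` or `- + -` likewise. The two minus intervals adjacent
  -- to `b` merge, which gives at most four changes.
  by_cases hexl : ∃ s, s < a ∧ 0 < f s
  · obtain ⟨s', hs', hfs'⟩ := hexl
    obtain ⟨u, hu1, hu2, hu3, hu4⟩ := exists_Ioo_of_initial hg.le_left hsub'
      (hg.initial_left hf hs' hfs')
    have hL1 : ∀ t, t ≠ a → t < u → 0 ≤ f t - g t := fun t ht h => by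
      rcases lt_or_gt_of_ne ht with h' | h'
      · exact hlt t h'
      · linarith [(hu3 ⟨h', h⟩).2]
    have hL2 : ∀ t, u < t → t < b → f t - g t ≤ 0 := fun t h h' => by
      have := hu4 t h
      simp only [Set.mem_ofPred_eq, not_and, not_le] at this
      linarith [this ⟨by linarith, h'⟩]
    by_cases hex : ∃ s, d < s ∧ 0 < f s
    · obtain ⟨s, hs, hfs⟩ := hex
      obtain ⟨x, hx1, hx2, hx3, hx4⟩ := exists_Ioo_of_final hg.le_right hsub
        (hg.final_right hf hs hfs)
      refine Or.inr (Or.inr ⟨[u, x], by simp, ?_⟩)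
      filter_upwards [ae_notMem_list [a, b, d]] with t ht
      simp only [List.mem_cons, List.not_mem_nil, or_false, not_or] at ht
      refine mul_prod_nonpos_of_two_sign_changes (hu2.trans hx1) (fun h => ?_) (fun h h' => ?_)
        (fun h => ?_)
      · linarith [hL1 t ht.1 h]
      · rcases lt_or_gt_of_ne ht.2.1 with hb | hb
        · linarith [hL2 t h hb]
        · have := hx4 t h'
          simp only [Set.mem_ofPred_eq, not_and, not_le] at this
          linarith [this ⟨hb, by linarith⟩]
      · rcases lt_or_gt_of_ne ht.2.2 with h' | h'
        · linarith [(hx3 ⟨h, h'⟩).2]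
        · linarith [hgt t h']
    · push Not at hex
      obtain ⟨x, y, hx1, hx2, hx3, hx4, hx5⟩ := exists_Ioo_of_ordConnected hg.le_right hsub
        (hg.ordConnected_right hf)
      refine Or.inr (Or.inl ⟨[u, x, y], by simp, ?_⟩)
      filter_upwards [ae_notMem_list [a, b, d]] with t ht
      simp only [List.mem_cons, List.not_mem_nil, or_false, not_or] at ht
      refine mul_prod_nonpos_of_three_sign_changes (hu2.trans hx1) hx2 (hL1 t ht.1)
        (fun h h' => ?_) (fun h h' => ?_) (fun h => ?_)
      · rcases lt_or_gt_of_ne ht.2.1 with hb | hb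
        · linarith [hL2 t h hb]
        · have := hx5 t (Or.inl h')
          simp only [Set.mem_ofPred_eq, not_and, not_le] at this
          linarith [this ⟨hb, by linarith⟩]
      · linarith [(hx4 ⟨h, h'⟩).2]
      · rcases lt_or_gt_of_ne ht.2.2 with h' | h'
        · have := hx5 t (Or.inr h)
          simp only [Set.mem_ofPred_eq, not_and, not_le] at this
          linarith [this ⟨by linarith, h'⟩]
        · rw [hg.gt_eq_zero t h', sub_zero]; exact hex t h'
  · push Not at hexl
    obtain ⟨u, v, hu1, hu2, hu3, hu4, hu5⟩ := exists_Ioo_of_ordConnected hg.le_left hsub'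
      (hg.ordConnected_left hf)
    have hL0 : ∀ t, t ≠ a → t < u → f t - g t ≤ 0 := fun t ht h => by
      rcases lt_or_gt_of_ne ht with h' | h'
      · rw [hg.lt_eq_zero t h', sub_zero]; exact hexl t h'
      · have := hu5 t (Or.inl h)
        simp only [Set.mem_ofPred_eq, not_and, not_le] at this
        linarith [this ⟨h', by linarith⟩]
    have hL1 : ∀ t, u < t → t < v → 0 ≤ f t - g t := fun t h h' => by
      linarith [(hu4 ⟨h, h'⟩).2]
    have hL2 : ∀ t, v < t → t < b → f t - g t ≤ 0 := fun t h h' => by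
      have := hu5 t (Or.inr h)
      simp only [Set.mem_ofPred_eq, not_and, not_le] at this
      linarith [this ⟨by linarith, h'⟩]
    by_cases hex : ∃ s, d < s ∧ 0 < f s
    · obtain ⟨s, hs, hfs⟩ := hex
      obtain ⟨x, hx1, hx2, hx3, hx4⟩ := exists_Ioo_of_final hg.le_right hsub
        (hg.final_right hf hs hfs)
      refine Or.inr (Or.inr ⟨[u, v, x], by simp, ?_⟩)
      filter_upwards [ae_notMem_list [a, b, d]] with t ht
      simp only [List.mem_cons, List.not_mem_nil, or_false, not_or] at ht
      refine mul_prod_nonpos_of_three_sign_changes hu2 (hu3.trans hx1) (fun h => ?_)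
        (fun h h' => ?_) (fun h h' => ?_) (fun h => ?_)
      · linarith [hL0 t ht.1 h]
      · linarith [hL1 t h h']
      · rcases lt_or_gt_of_ne ht.2.1 with hb | hb
        · linarith [hL2 t h hb]
        · have := hx4 t h'
          simp only [Set.mem_ofPred_eq, not_and, not_le] at this
          linarith [this ⟨hb, by linarith⟩]
      · rcases lt_or_gt_of_ne ht.2.2 with h' | h'
        · linarith [(hx3 ⟨h, h'⟩).2]
        · linarith [hgt t h']
    · push Not at hex
      obtain ⟨x, y, hx1, hx2, hx3, hx4, hx5⟩ := exists_Ioo_of_ordConnected hg.le_right hsub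
        (hg.ordConnected_right hf)
      refine Or.inl ⟨[u, v, x, y], rfl, ?_⟩
      filter_upwards [ae_notMem_list [a, b, d]] with t ht
      simp only [List.mem_cons, List.not_mem_nil, or_false, not_or] at ht
      refine mul_prod_nonpos_of_four_sign_changes hu2 (hu3.trans hx1) hx2 (hL0 t ht.1) (hL1 t)
        (fun h h' => ?_) (fun h h' => ?_) (fun h => ?_)
      · rcases lt_or_gt_of_ne ht.2.1 with hb | hb
        · linarith [hL2 t h hb]
        · have := hx5 t (Or.inl h')
          simp only [Set.mem_ofPred_eq, not_and, not_le] at this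
          linarith [this ⟨hb, by linarith⟩]
      · linarith [(hx4 ⟨h, h'⟩).2]
      · rcases lt_or_gt_of_ne ht.2.2 with h' | h'
        · have := hx5 t (Or.inr h)
          simp only [Set.mem_ofPred_eq, not_and, not_le] at this
          linarith [this ⟨by linarith, h'⟩]
        · rw [hg.gt_eq_zero t h', sub_zero]; exact hex t h'

theorem integral_sub_mul_pow_eq_zero (hfi : IntegrableBddSupport f) (hgi : IntegrableBddSupport g)
    {j : ℕ} (h : ∫ t, f t * t ^ j = ∫ t, g t * t ^ j) : ∫ t, (f t - g t) * t ^ j = 0 := by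
  simp_rw [sub_mul]
  rw [integral_sub (hfi.mul_continuous (continuous_pow j)) (hgi.mul_continuous (continuous_pow j)),
    h, sub_self]

theorem ae_eq_zero_of_list_sign_neg {D : ℝ → ℝ} (hD : IntegrableBddSupport D) {k : ℕ}
    (hm : ∀ j < k, ∫ t, D t * t ^ j = 0) (L : List ℝ) (hL : L.length < k)
    (hs : ∀ᵐ t, -D t * (L.map fun x => t - x).prod ≤ 0) : D =ᵐ[volume] 0 := by
  have hD' : IntegrableBddSupport fun t => -D t :=
    ⟨hD.integrable.neg, hD.bounded.imp fun R hR t ht => by rw [hR t ht, neg_zero]⟩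
  have := ae_eq_zero_of_list_sign hD' (k := k) (fun j hj => by
    simp_rw [neg_mul]; rw [integral_neg, hm j hj, neg_zero]) L hL hs
  filter_upwards [this] with t ht
  simpa using ht

/-- Among densities with given moments of order at most two, the cone density maximizes the
integral of functions with positive third derivative, and it is the only maximizer. -/
theorem TentDensity.integral_le_cone (hf : PowConcave p f) (hg : TentDensity p g a a d c)
    (hfi : IntegrableBddSupport f) (hgi : IntegrableBddSupport g)
    (hm : ∀ j < 3, ∫ t, f t * t ^ j = ∫ t, g t * t ^ j)
    {φ : ℝ → ℝ} (hφ : ContDiff ℝ 3 φ) (hpos : ∀ x, 0 < iteratedDeriv 3 φ x) :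
    ∫ t, f t * φ t ≤ ∫ t, g t * φ t ∧ (∫ t, f t * φ t = ∫ t, g t * φ t → f =ᵐ[volume] g) := by
  have hD := hfi.sub hgi
  have hm' : ∀ j < 3, ∫ t, (f t - g t) * t ^ j = 0 := fun j hj =>
    integral_sub_mul_pow_eq_zero hfi hgi (hm j hj)
  have hint : ∫ t, (f t - g t) * φ t = (∫ t, f t * φ t) - ∫ t, g t * φ t := by
    simp_rw [sub_mul]
    exact integral_sub (hfi.mul_continuous hφ.continuous) (hgi.mul_continuous hφ.continuous)
  have key : ∫ t, (f t - g t) * φ t ≤ 0 ∧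
      (∫ t, (f t - g t) * φ t = 0 → (fun t => f t - g t) =ᵐ[volume] 0) := by
    rcases hg.sign_changes_cone hf with ⟨L, hL, hs⟩ | ⟨L, hL, hs⟩
    · exact integral_mul_nonpos_of_list_sign hD hm' L hL.le hs (by exact_mod_cast hφ) hpos
    · have h0 := ae_eq_zero_of_list_sign_neg hD hm' L (by omega) hs
      refine ⟨le_of_eq (integral_eq_zero_of_ae ?_), fun _ => h0⟩
      filter_upwards [h0] with t ht
      simp only [Pi.zero_apply] at ht
      simp [ht]
  rw [hint] at key
  refine ⟨by linarith [key.1], fun h => ?_⟩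
  filter_upwards [key.2 (by linarith)] with t ht
  simpa [sub_eq_zero] using ht

/-- The peak in the interior allows a fourth sign change, so agreement of the third moments and a
positive fourth derivative are needed. -/
theorem TentDensity.integral_le (hf : PowConcave p f) (hg : TentDensity p g a b d c)
    (hfi : IntegrableBddSupport f) (hgi : IntegrableBddSupport g)
    (hm : ∀ j < 4, ∫ t, f t * t ^ j = ∫ t, g t * t ^ j)
    {φ : ℝ → ℝ} (hφ : ContDiff ℝ 4 φ) (hpos : ∀ x, 0 < iteratedDeriv 4 φ x) :
    ∫ t, f t * φ t ≤ ∫ t, g t * φ t := by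
  have hD := hfi.sub hgi
  have hm' : ∀ j < 4, ∫ t, (f t - g t) * t ^ j = 0 := fun j hj =>
    integral_sub_mul_pow_eq_zero hfi hgi (hm j hj)
  have hint : ∫ t, (f t - g t) * φ t = (∫ t, f t * φ t) - ∫ t, g t * φ t := by
    simp_rw [sub_mul]
    exact integral_sub (hfi.mul_continuous hφ.continuous) (hgi.mul_continuous hφ.continuous)
  have key : ∫ t, (f t - g t) * φ t ≤ 0 := by
    rcases hg.sign_changes hf with ⟨L, hL, hs⟩ | ⟨L, hL, hs⟩ | ⟨L, hL, hs⟩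
    · exact (integral_mul_nonpos_of_list_sign hD hm' L hL.le hs (by exact_mod_cast hφ) hpos).1
    · exact (integral_mul_nonpos_of_list_sign hD hm' L (by omega) hs (by exact_mod_cast hφ) hpos).1
    · have h0 := ae_eq_zero_of_list_sign_neg hD hm' L (by omega) hs
      refine le_of_eq (integral_eq_zero_of_ae ?_)
      filter_upwards [h0] with t ht
      simp only [Pi.zero_apply] at ht
      simp [ht]
  linarith

end

/-! ### Directions in which a body is a cone or a double cone. -/

/-- In direction `θ`, the part of `L` above the level `b` is a cone with base at level `b` and apex
at level `d`, and the part below is a cone with apex at level `a`. -/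
structure TentDirection {n : ℕ} (L : Set (EuclideanSpace ℝ (Fin n)))
    (θ : EuclideanSpace ℝ (Fin n)) (a b d : ℝ) : Prop where
  le_left : a ≤ b
  le_right : b ≤ d
  lower : ∀ x ∈ L, a ≤ inner ℝ x θ
  upper : ∀ x ∈ L, inner ℝ x θ ≤ d
  left : a < b → ∃ q ∈ L, inner ℝ q θ = a ∧ ∀ r : ℝ, 0 < r → r ≤ 1 → ∀ x ∈ L,
    inner ℝ x θ ≤ a + r * (b - a) → q + r⁻¹ • (x - q) ∈ L
  right : b < d → ∃ q ∈ L, inner ℝ q θ = d ∧ ∀ r : ℝ, 0 < r → r ≤ 1 → ∀ x ∈ L,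
    d - r * (d - b) ≤ inner ℝ x θ → q + r⁻¹ • (x - q) ∈ L

theorem TentDirection.neg {n : ℕ} {L : Set (EuclideanSpace ℝ (Fin n))}
    {θ : EuclideanSpace ℝ (Fin n)} {a b d : ℝ} (h : TentDirection L θ a b d) :
    TentDirection L (-θ) (-d) (-b) (-a) where
  le_left := neg_le_neg h.le_right
  le_right := neg_le_neg h.le_left
  lower x hx := by rw [inner_neg_right]; exact neg_le_neg (h.upper x hx)
  upper x hx := by rw [inner_neg_right]; exact neg_le_neg (h.lower x hx)
  left hlt := by
    obtain ⟨q, hq, hqd, hq'⟩ := h.right (neg_lt_neg_iff.1 hlt)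
    refine ⟨q, hq, by rw [inner_neg_right, hqd], fun r hr hr1 x hx hxr => hq' r hr hr1 x hx ?_⟩
    rw [inner_neg_right] at hxr
    linarith
  right hlt := by
    obtain ⟨q, hq, hqd, hq'⟩ := h.left (neg_lt_neg_iff.1 hlt)
    refine ⟨q, hq, by rw [inner_neg_right, hqd], fun r hr hr1 x hx hxr => hq' r hr hr1 x hx ?_⟩
    rw [inner_neg_right] at hxr
    linarith

section
variable {p : ℕ} {θ : EuclideanSpace ℝ (Fin (p + 1))}
  {Φ : EuclideanSpace ℝ (Fin (p + 1)) ≃ₗ[ℝ] ℝ × (Fin p → ℝ)}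
  {K : Set (EuclideanSpace ℝ (Fin (p + 1)))}

theorem powConcave_sliceDensity (hθ : ∀ x, (Φ x).1 = inner ℝ x θ) (hK : IsConvexBody K) :
    PowConcave p (sliceDensity Φ K) where
  nonneg := sliceDensity_nonneg
  combo := sliceDensity_combo hK
  homothety := by
    intro s t a r ha hr har hs
    obtain ⟨q, hq, rfl⟩ := exists_mem_of_sliceDensity_pos hθ hs
    exact sliceDensity_homothety_le hθ hK hq ha hr har t

theorem TentDirection.tentDensity (hθ : ∀ x, (Φ x).1 = inner ℝ x θ) (hK : IsConvexBody K)
    {a b d : ℝ} (h : TentDirection K θ a b d) :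
    TentDensity p (sliceDensity Φ K) a b d (sliceDensity Φ K b) where
  le_left := h.le_left
  le_right := h.le_right
  nonneg := sliceDensity_nonneg b
  lt_eq_zero t ht := sliceDensity_eq_zero hθ fun x hx hxt => by linarith [h.lower x hx]
  gt_eq_zero t ht := sliceDensity_eq_zero hθ fun x hx hxt => by linarith [h.upper x hx]
  left t ht := by
    have hba : 0 < b - a := by linarith [ht.1, ht.2]
    obtain ⟨q, hq, hqa, hq'⟩ := h.left (by linarith)
    have hr1 : (t - a) / (b - a) ≤ 1 := by rw [div_le_one hba]; linarith [ht.2]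
    have hr0 : 0 < (t - a) / (b - a) := div_pos (by linarith [ht.1]) hba
    rw [mul_comm, sliceDensity_eq_of_homothety hθ hK hq hr0 hr1 (b := b)]
    · rw [hqa]; field_simp; ring
    · refine fun x hx hxt => hq' _ hr0 hr1 x hx (le_of_eq ?_)
      rw [hxt]; field_simp; ring
  right t ht := by
    have hba : 0 < d - b := by linarith [ht.1, ht.2]
    obtain ⟨q, hq, hqa, hq'⟩ := h.right (by linarith)
    have hr1 : (d - t) / (d - b) ≤ 1 := by rw [div_le_one hba]; linarith [ht.1]
    have hr0 : 0 < (d - t) / (d - b) := div_pos (by linarith [ht.2]) hba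
    rw [mul_comm, sliceDensity_eq_of_homothety hθ hK hq hr0 hr1 (b := b)]
    · rw [hqa]; field_simp; ring
    · refine fun x hx hxt => hq' _ hr0 hr1 x hx (le_of_eq ?_)
      rw [hxt]; field_simp; ring

end

/-! ### Isotropy and the comparison of marginals. -/

section
variable {n : ℕ} {K L : Set (EuclideanSpace ℝ (Fin n))} {θ η : EuclideanSpace ℝ (Fin n)}

theorem IsConvexBody.integrable (hK : IsConvexBody K) {h : EuclideanSpace ℝ (Fin n) → ℝ}
    (hh : Continuous h) : Integrable h (uniformLaw K) := by
  unfold uniformLaw ProbabilityTheory.cond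
  exact (hh.continuousOn.integrableOn_compact hK.2.1).smul_measure
    (ENNReal.inv_ne_top.2 hK.volume_ne_zero)

theorem IsIsotropic.integral_inner (hK : IsConvexBody K) (h : IsIsotropic K) :
    ∫ x, inner ℝ x θ ∂(uniformLaw K) = 0 := by
  simp_rw [PiLp.inner_apply]
  rw [integral_finsetSum _ fun i _ => hK.integrable (by fun_prop)]
  refine Finset.sum_eq_zero fun i _ => ?_
  simp [integral_const_mul, h.1 i]

theorem IsIsotropic.integral_inner_sq (hK : IsConvexBody K) (h : IsIsotropic K) :
    ∫ x, (inner ℝ x θ) ^ 2 ∂(uniformLaw K) = ‖θ‖ ^ 2 := by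
  have e : ∀ x : EuclideanSpace ℝ (Fin n), (inner ℝ x θ : ℝ) ^ 2 =
      ∑ i, ∑ j, θ i * θ j * (x i * x j) := by
    intro x
    rw [PiLp.inner_apply, sq, Finset.sum_mul_sum]
    refine Finset.sum_congr rfl fun i _ => Finset.sum_congr rfl fun j _ => ?_
    simp
    ring
  simp_rw [e]
  rw [integral_finsetSum _ fun i _ => hK.integrable (by fun_prop)]
  have e2 : ∀ i, ∫ x, ∑ j, θ i * θ j * (x i * x j) ∂(uniformLaw K) = θ i * θ i := by
    intro i
    rw [integral_finsetSum _ fun j _ => hK.integrable (by fun_prop)]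
    simp_rw [integral_const_mul, h.2]
    simp
  simp_rw [e2]
  rw [EuclideanSpace.norm_sq_eq]
  exact Finset.sum_congr rfl fun i _ => by simp [sq]

theorem IsIsotropic.integral_inner_pow_eq (hK : IsConvexBody K) (hKi : IsIsotropic K)
    (hL : IsConvexBody L) (hLi : IsIsotropic L) (hθ : ‖θ‖ = 1) (hη : ‖η‖ = 1) :
    ∀ j < 3, ∫ x, (inner ℝ x θ : ℝ) ^ j ∂(uniformLaw K) =
      ∫ x, (inner ℝ x η : ℝ) ^ j ∂(uniformLaw L) := by
  intro j hj
  have := hK.isProbabilityMeasure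
  have := hL.isProbabilityMeasure
  interval_cases j
  · simp
  · simp [hKi.integral_inner hK, hLi.integral_inner hL]
  · rw [hKi.integral_inner_sq hK, hLi.integral_inner_sq hL, hθ, hη]

end

section
variable {p : ℕ} {K L : Set (EuclideanSpace ℝ (Fin (p + 1)))}
  {θ η : EuclideanSpace ℝ (Fin (p + 1))} {a b d : ℝ} {φ : ℝ → ℝ}

/-- Isotropy makes the moments of order 0, 1 and 2 of all marginals agree, so the comparison with
the cone density applies to every direction of `K`. -/
theorem TentDirection.marginalExp_le_cone (hK : IsConvexBody K) (hKi : IsIsotropic K)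
    (hL : IsConvexBody L) (hLi : IsIsotropic L) (hθ : ‖θ‖ = 1) (hη : ‖η‖ = 1)
    (h : TentDirection L η a a d) (hφ : ContDiff ℝ 3 φ) (hpos : ∀ x, 0 < iteratedDeriv 3 φ x) :
    marginalExp K φ θ ≤ marginalExp L φ η ∧ (marginalExp K φ θ = marginalExp L φ η →
      (uniformLaw K).map (fun x => inner ℝ x θ) = (uniformLaw L).map (fun x => inner ℝ x η)) := by
  obtain ⟨Φ, hΦ, hΦθ⟩ := exists_slicing hθ
  obtain ⟨Ψ, hΨ, hΨη⟩ := exists_slicing hη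
  have hm : ∀ j < 3, ∫ t, sliceDensity Φ K t * t ^ j = ∫ t, sliceDensity Ψ L t * t ^ j := by
    intro j hj
    rw [← integral_uniformLaw_inner hΦ hΦθ hK (continuous_pow j),
      ← integral_uniformLaw_inner hΨ hΨη hL (continuous_pow j)]
    exact hKi.integral_inner_pow_eq hK hL hLi hθ hη j hj
  have key := (h.tentDensity hΨη hL).integral_le_cone (powConcave_sliceDensity hΦθ hK)
    (integrableBddSupport_sliceDensity hΦ hΦθ hK) (integrableBddSupport_sliceDensity hΨ hΨη hL)
    hm hφ hpos
  rw [← integral_uniformLaw_inner hΦ hΦθ hK hφ.continuous,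
    ← integral_uniformLaw_inner hΨ hΨη hL hφ.continuous] at key
  refine ⟨key.1, fun he => ?_⟩
  rw [map_uniformLaw_eq_withDensity hΦ hΦθ hK, map_uniformLaw_eq_withDensity hΨ hΨη hL]
  refine withDensity_congr_ae ?_
  filter_upwards [key.2 he] with t ht
  rw [ht]

theorem TentDirection.marginalExp_le (hK : IsConvexBody K) (hKi : IsIsotropic K)
    (hL : IsConvexBody L) (hLi : IsIsotropic L) (hθ : ‖θ‖ = 1) (hη : ‖η‖ = 1)
    (h : TentDirection L η a b d)
    (h3 : marginalExp K (fun t => t ^ 3) θ = marginalExp L (fun t => t ^ 3) η)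
    (hφ : ContDiff ℝ 4 φ) (hpos : ∀ x, 0 < iteratedDeriv 4 φ x) :
    marginalExp K φ θ ≤ marginalExp L φ η := by
  obtain ⟨Φ, hΦ, hΦθ⟩ := exists_slicing hθ
  obtain ⟨Ψ, hΨ, hΨη⟩ := exists_slicing hη
  have hm : ∀ j < 4, ∫ t, sliceDensity Φ K t * t ^ j = ∫ t, sliceDensity Ψ L t * t ^ j := by
    intro j hj
    rw [← integral_uniformLaw_inner hΦ hΦθ hK (continuous_pow j),
      ← integral_uniformLaw_inner hΨ hΨη hL (continuous_pow j)]
    rcases Nat.lt_succ_iff_lt_or_eq.1 hj with hj | rfl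
    · exact hKi.integral_inner_pow_eq hK hL hLi hθ hη j hj
    · exact h3
  have key := (h.tentDensity hΨη hL).integral_le (powConcave_sliceDensity hΦθ hK)
    (integrableBddSupport_sliceDensity hΦ hΦθ hK) (integrableBddSupport_sliceDensity hΨ hΨη hL)
    hm hφ hpos
  rwa [← integral_uniformLaw_inner hΦ hΦθ hK hφ.continuous,
    ← integral_uniformLaw_inner hΨ hΨη hL hφ.continuous] at key

end

section
variable {n : ℕ} {K : Set (EuclideanSpace ℝ (Fin n))} {φ : ℝ → ℝ}

theorem continuous_marginalExp (hK : IsConvexBody K) (hφ : Continuous φ) :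
    Continuous (marginalExp K φ) := by
  have h : Continuous fun θ : EuclideanSpace ℝ (Fin n) => ∫ x in K, φ (inner ℝ x θ) :=
    continuous_parametric_integral_of_continuous
      (f := fun θ x : EuclideanSpace ℝ (Fin n) => φ (inner ℝ x θ))
      (hφ.comp (continuous_snd.inner continuous_fst)) hK.2.1
  have e : marginalExp K φ = fun θ => ((volume K)⁻¹).toReal * ∫ x in K, φ (inner ℝ x θ) := by
    ext θ
    unfold marginalExp uniformLaw ProbabilityTheory.cond
    rw [integral_smul_measure, smul_eq_mul]
  rw [e]
  exact continuous_const.mul h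

theorem exists_isMaxMarginal (hn : 1 ≤ n) (hK : IsConvexBody K) (hφ : Continuous φ) :
    ∃ θ : EuclideanSpace ℝ (Fin n), ‖θ‖ = 1 ∧ IsMaxMarginal K φ (marginalExp K φ θ) := by
  have : Nonempty (Fin n) := ⟨⟨0, hn⟩⟩
  have hne : (Metric.sphere (0 : EuclideanSpace ℝ (Fin n)) 1).Nonempty :=
    ⟨EuclideanSpace.single ⟨0, hn⟩ 1, by simp⟩
  obtain ⟨θ, hθ, hmax⟩ := (isCompact_sphere (0 : EuclideanSpace ℝ (Fin n)) 1).exists_isMaxOn hne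
    (continuous_marginalExp hK hφ).continuousOn
  refine ⟨θ, by simpa using hθ, ⟨θ, hθ, rfl⟩, ?_⟩
  rintro _ ⟨η, hη, rfl⟩
  exact hmax hη

end

/-! ### The equality case: cones are determined by one marginal. -/

section
variable {n : ℕ} {K L : Set (EuclideanSpace ℝ (Fin n))} {θ η : EuclideanSpace ℝ (Fin n)}

/-- The interior of a convex body is dense in it. This turns statements about null sets into
statements about all points. -/
theorem IsConvexBody.uniformLaw_pos (hK : IsConvexBody K) {U : Set (EuclideanSpace ℝ (Fin n))}
    (hU : IsOpen U) (hne : (K ∩ U).Nonempty) : 0 < uniformLaw K (K ∩ U) := by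
  obtain ⟨x, hx, hxU⟩ := hne
  have hcl : x ∈ closure (interior K) := by
    rw [hK.1.closure_interior_eq_closure_of_nonempty_interior hK.2.2]
    exact subset_closure hx
  obtain ⟨y, hyU, hyK⟩ := mem_closure_iff.1 hcl U hU hxU
  have hpos : 0 < volume (interior K ∩ U) :=
    (isOpen_interior.inter hU).measure_pos _ ⟨y, hyK, hyU⟩
  rw [uniformLaw, cond_apply hK.measurableSet]
  refine ENNReal.mul_pos (ENNReal.inv_ne_zero.2 hK.volume_ne_top) ?_
  refine (hpos.trans_le (measure_mono ?_)).ne'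
  exact fun z hz => ⟨interior_subset hz.1, interior_subset hz.1, hz.2⟩

theorem uniformLaw_inter (hK : IsConvexBody K) (A : Set (EuclideanSpace ℝ (Fin n))) :
    uniformLaw K (K ∩ A) = uniformLaw K A := by
  rw [uniformLaw, cond_inter_self hK.measurableSet]

theorem uniformLaw_homothety (hK : IsConvexBody K) {q : EuclideanSpace ℝ (Fin n)} {r : ℝ}
    (hr : 0 < r) (hsub : AffineMap.homothety q r '' K ⊆ K) :
    uniformLaw K (AffineMap.homothety q r '' K) = ENNReal.ofReal (r ^ n) := by
  rw [uniformLaw, cond_apply hK.measurableSet, Set.inter_eq_right.2 hsub,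
    Measure.addHaar_image_homothety, finrank_euclideanSpace_fin, abs_of_pos (pow_pos hr n),
    mul_left_comm, ENNReal.inv_mul_cancel hK.volume_ne_zero hK.volume_ne_top, mul_one]

theorem homothety_image_subset (hK : IsConvexBody K) {q : EuclideanSpace ℝ (Fin n)} (hq : q ∈ K)
    {r : ℝ} (hr : 0 < r) (hr1 : r ≤ 1) : AffineMap.homothety q r '' K ⊆ K := by
  rintro _ ⟨x, hx, rfl⟩
  have := hK.1 hq hx (show 0 ≤ 1 - r by linarith) hr.le (by ring)
  convert this using 1
  rw [AffineMap.homothety_apply, vsub_eq_sub, vadd_eq_add, smul_sub, sub_smul, one_smul]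
  abel

theorem mem_homothety_image {q x : EuclideanSpace ℝ (Fin n)} {r : ℝ} (hr : 0 < r) :
    x ∈ AffineMap.homothety q r '' K ↔ q + r⁻¹ • (x - q) ∈ K := by
  constructor
  · rintro ⟨y, hy, rfl⟩
    convert hy using 1
    rw [AffineMap.homothety_apply, vsub_eq_sub, vadd_eq_add, add_sub_cancel_right, smul_smul,
      inv_mul_cancel₀ hr.ne', one_smul, add_sub_cancel]
  · intro h
    refine ⟨_, h, ?_⟩
    rw [AffineMap.homothety_apply, vsub_eq_sub, vadd_eq_add, add_sub_cancel_left, smul_smul,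
      mul_inv_cancel₀ hr.ne', one_smul, sub_add_cancel]

/-- A convex body with the marginal of a cone in direction `θ` is a cone in direction `θ`. -/
theorem TentDirection.of_map_eq (hK : IsConvexBody K) (hL : IsConvexBody L) {a d : ℝ}
    (had : a < d) (h : TentDirection L η a a d)
    (he : (uniformLaw K).map (fun x => inner ℝ x θ) =
      (uniformLaw L).map (fun x => inner ℝ x η)) : TentDirection K θ a a d := by
  have hin : ∀ ζ : EuclideanSpace ℝ (Fin n), Continuous fun x : EuclideanSpace ℝ (Fin n) =>
    (inner ℝ x ζ : ℝ) := fun ζ => continuous_id.inner continuous_const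
  have hlaw : ∀ A : Set ℝ, MeasurableSet A → uniformLaw K {x | inner ℝ x θ ∈ A} =
      uniformLaw L {x | inner ℝ x η ∈ A} := by
    intro A hA
    have := congrArg (fun μ => μ A) he
    simp only [Measure.map_apply (hin θ).measurable hA, Measure.map_apply (hin η).measurable hA]
      at this
    exact this
  have hempty : ∀ A : Set ℝ, IsOpen A → (∀ x ∈ L, inner ℝ x η ∉ A) →
      ∀ x ∈ K, inner ℝ x θ ∉ A := by
    intro A hA hLA x hx hxA
    have h1 := hK.uniformLaw_pos (hA.preimage (hin θ)) ⟨x, hx, hxA⟩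
    rw [uniformLaw_inter hK] at h1
    have h2 := hlaw A hA.measurableSet
    have h3 : L ∩ {x | inner ℝ x η ∈ A} = ∅ := by
      ext y
      simp only [Set.mem_inter_iff, Set.mem_ofPred_eq, Set.mem_empty_iff_false, iff_false, not_and]
      exact hLA y
    rw [← uniformLaw_inter hL, h3, measure_empty] at h2
    exact h1.ne' h2
  have hlow : ∀ x ∈ K, a ≤ inner ℝ x θ := fun x hx => by
    have := hempty (Set.Iio a) isOpen_Iio (fun y hy => by simpa using h.lower y hy) x hx
    simpa using this
  have hupp : ∀ x ∈ K, inner ℝ x θ ≤ d := fun x hx => by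
    have := hempty (Set.Ioi d) isOpen_Ioi (fun y hy => by simpa using h.upper y hy) x hx
    simpa using this
  obtain ⟨q', hq', hq'd, hhom⟩ := h.right had
  -- A highest point of `K` in direction `θ` is the apex to be; equality of the laws puts it at
  -- level `d`.
  obtain ⟨q, hq, hmax⟩ := hK.2.1.exists_isMaxOn (hK.2.2.mono interior_subset)
    (hin θ).continuousOn
  have hqd : inner ℝ q θ = d := by
    refine le_antisymm (hupp q hq) (not_lt.1 fun hlt => ?_)
    have h1 := hL.uniformLaw_pos (isOpen_Ioi.preimage (hin η))
      ⟨q', hq', show inner ℝ q' η ∈ Set.Ioi (inner ℝ q θ) by rw [hq'd]; exact hlt⟩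
    rw [uniformLaw_inter hL] at h1
    have h2 := hlaw (Set.Ioi (inner ℝ q θ)) measurableSet_Ioi
    have h3 : K ∩ {x | inner ℝ x θ ∈ Set.Ioi (inner ℝ q θ)} = ∅ := by
      ext y
      simp only [Set.mem_inter_iff, Set.mem_ofPred_eq, Set.mem_empty_iff_false, iff_false, not_and,
        Set.mem_Ioi, not_lt]
      exact fun hy => hmax hy
    rw [← uniformLaw_inter hK, h3, measure_empty] at h2
    exact h1.ne h2
  -- The homothetic copy `Hr` of `K` lies in `K` above the level `d - r (d - a)` and has probability
  -- `r ^ n`. The part of `K` above that level has at most this probability, because its law is that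
  -- of the cone `L`. So the difference is null, while a point strictly above the level and outside
  -- the closed set `Hr` would have a neighbourhood of positive mass.
  have hstrict : ∀ r : ℝ, 0 < r → r ≤ 1 → ∀ x ∈ K, d - r * (d - a) < inner ℝ x θ →
      q + r⁻¹ • (x - q) ∈ K := by
    intro r hr hr1 x hx hxr
    by_contra hcon
    rw [← mem_homothety_image hr] at hcon
    set Hr := AffineMap.homothety q r '' K with hHr
    have hHc : IsCompact Hr := hK.2.1.image (AffineMap.homothety_continuous q r)
    have hsub : Hr ⊆ K := homothety_image_subset hK hq hr hr1
    set S := {x | inner ℝ x θ ∈ Set.Ici (d - r * (d - a))} with hS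
    have hSle : uniformLaw K S ≤ ENNReal.ofReal (r ^ n) := by
      rw [hlaw _ measurableSet_Ici, ← uniformLaw_inter hL,
        ← uniformLaw_homothety hL hr (homothety_image_subset hL hq' hr hr1)]
      refine measure_mono fun y hy => ?_
      rw [mem_homothety_image hr]
      exact hhom r hr hr1 y hy.1 hy.2
    have hHS : Hr ⊆ S := by
      rintro _ ⟨y, hy, rfl⟩
      have h1 := hlow y hy
      simp only [hS, Set.mem_ofPred_eq, Set.mem_Ici, AffineMap.homothety_apply, vsub_eq_sub,
        vadd_eq_add, inner_add_left, inner_smul_left, inner_sub_left, hqd]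
      simp only [conj_trivial]
      nlinarith
    have := hK.isProbabilityMeasure
    have hpos := hK.uniformLaw_pos
      ((isOpen_Ioi.preimage (hin θ)).inter hHc.isClosed.isOpen_compl)
      ⟨x, hx, show inner ℝ x θ ∈ Set.Ioi (d - r * (d - a)) from hxr, hcon⟩
    have hdiff : uniformLaw K (S \ Hr) = 0 := by
      rw [measure_sdiff hHS hHc.measurableSet.nullMeasurableSet (measure_ne_top _ _),
        uniformLaw_homothety hK hr hsub]
      exact tsub_eq_zero_of_le hSle
    refine hpos.ne' (measure_mono_null ?_ hdiff)
    rintro y ⟨_, hy1, hy2⟩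
    exact ⟨show d - r * (d - a) ≤ inner ℝ y θ from le_of_lt hy1, hy2⟩
  refine ⟨le_rfl, had.le, hlow, hupp, fun hlt => absurd hlt (lt_irrefl a), fun _ =>
    ⟨q, hq, hqd, fun r hr hr1 x hx hxr => ?_⟩⟩
  -- On the level itself, let `s` decrease to `r` and use that `K` is closed; `r = 1` is trivial.
  rcases hr1.lt_or_eq with hr1 | rfl
  · have hlim : Filter.Tendsto (fun s : ℝ => q + s⁻¹ • (x - q)) (nhdsWithin r (Set.Ioi r))
        (nhds (q + r⁻¹ • (x - q))) := by
      refine (ContinuousAt.tendsto ?_).mono_left nhdsWithin_le_nhds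
      have : r ≠ 0 := hr.ne'
      fun_prop (disch := assumption)
    refine hK.2.1.isClosed.mem_of_tendsto hlim ?_
    filter_upwards [Ioo_mem_nhdsGT hr1] with s hs
    refine hstrict s (hr.trans hs.1) hs.2.le x hx ?_
    nlinarith [hs.1]
  · simpa using hx

/-- A set with the cone property in direction `θ` is a cone with base orthogonal to `θ`. -/
theorem TentDirection.isConeWithBaseIn (hK : IsConvexBody K) (hθ : ‖θ‖ = 1) {a d : ℝ}
    (had : a < d) (h : TentDirection K θ a a d) :
    ∃ H : AffineSubspace ℝ (EuclideanSpace ℝ (Fin n)), IsConeWithBaseIn K H ∧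
      θ ∈ H.directionᗮ := by
  have hθ0 : θ ≠ 0 := fun h0 => by simp [h0] at hθ
  have hθθ : (inner ℝ θ θ : ℝ) = 1 := by rw [real_inner_self_eq_norm_sq, hθ]; norm_num
  set H := AffineSubspace.mk' (a • θ) (ℝ ∙ θ)ᗮ with hH
  have hmem : ∀ x, x ∈ H ↔ inner ℝ x θ = a := by
    intro x
    rw [hH, AffineSubspace.mem_mk', Submodule.mem_orthogonal_singleton_iff_inner_left, vsub_eq_sub,
      inner_sub_left, inner_smul_left, hθθ]
    simp [sub_eq_zero]
  have hdir : H.direction = (ℝ ∙ θ)ᗮ := AffineSubspace.direction_mk' _ _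
  obtain ⟨q, hq, hqd, hq'⟩ := h.right had
  refine ⟨H, ⟨⟨⟨a • θ, AffineSubspace.self_mem_mk' _ _⟩, ?_⟩, K ∩ H, q, Set.inter_subset_right,
    ?_, ?_⟩, ?_⟩
  · rw [hdir]
    have h1 := Submodule.finrank_add_finrank_orthogonal (ℝ ∙ θ)
    rw [finrank_span_singleton hθ0, finrank_euclideanSpace_fin] at h1
    omega
  · rw [hmem, hqd]
    exact had.ne'
  · refine Set.Subset.antisymm (fun x hx => ?_) ?_
    · have hqC : q ∈ convexHull ℝ (insert q (K ∩ (H : Set (EuclideanSpace ℝ (Fin n))))) :=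
        subset_convexHull ℝ _ (Set.mem_insert _ _)
      rcases (h.upper x hx).lt_or_eq with hlt | heq
      · have hda : 0 < d - a := by linarith
        -- The ratio for which the expansion of `x` from `q` lands on the hyperplane `H`.
        set r := (d - inner ℝ x θ) / (d - a) with hr
        have hr0 : 0 < r := div_pos (by linarith) hda
        have hr1 : r ≤ 1 := by rw [hr, div_le_one hda]; linarith [h.lower x hx]
        have hrd : r * (d - a) = d - inner ℝ x θ := by rw [hr]; field_simp
        have hy := hq' r hr0 hr1 x hx (by rw [hrd]; linarith)
        have hyH : q + r⁻¹ • (x - q) ∈ H := by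
          rw [hmem, inner_add_left, inner_smul_left, inner_sub_left, hqd]
          simp only [conj_trivial]
          field_simp
          linarith
        have hyC : q + r⁻¹ • (x - q) ∈
            convexHull ℝ (insert q (K ∩ (H : Set (EuclideanSpace ℝ (Fin n))))) :=
          subset_convexHull ℝ _ (Set.mem_insert_of_mem _ ⟨hy, hyH⟩)
        have := convex_convexHull ℝ _ hqC hyC (show 0 ≤ 1 - r by linarith) hr0.le (by ring)
        convert this using 1
        rw [smul_add, smul_smul, mul_inv_cancel₀ hr0.ne', sub_smul, one_smul, one_smul]
        abel
      -- At the level of the apex every ratio `r > 0` is allowed, so `x ≠ q` could be expanded to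
      -- points arbitrarily far away. The chosen `r` makes the displacement exceed the bound `2 *
      -- R`.
      · have hxq : x = q := by
          obtain ⟨R, hR⟩ := hK.2.1.isBounded.exists_norm_le
          by_contra hne
          have hpos : 0 < ‖x - q‖ := norm_pos_iff.2 (sub_ne_zero.2 hne)
          have hR0 : 0 ≤ R := (norm_nonneg _).trans (hR q hq)
          set r := min 1 (‖x - q‖ / (2 * R + 1)) with hr
          have hr0 : 0 < r := lt_min one_pos (by positivity)
          have hy := hR _ (hq' r hr0 (min_le_left _ _) x hx (by rw [heq]; nlinarith))
          have h1 : ‖r⁻¹ • (x - q)‖ ≤ 2 * R := by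
            have e : r⁻¹ • (x - q) = (q + r⁻¹ • (x - q)) - q := by abel
            rw [e]
            exact (norm_sub_le _ _).trans (by linarith [hR q hq])
          rw [norm_smul, norm_inv, Real.norm_of_nonneg hr0.le, inv_mul_le_iff₀ hr0] at h1
          have h2 : r ≤ ‖x - q‖ / (2 * R + 1) := min_le_right _ _
          rw [le_div_iff₀ (by positivity)] at h2
          linarith
        rw [hxq]; exact hqC
    · exact convexHull_min (Set.insert_subset hq Set.inter_subset_left) hK.1
  · rw [hdir]
    exact Submodule.le_orthogonal_orthogonal _ (Submodule.mem_span_singleton_self θ)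

/-- Take for `θ` the unit normal of the hyperplane pointing towards the apex. Each point of the cone
is `q + l (y - q)` with `y` in the hull of the base, and its level determines `l`. Being above the
level `d - r (d - a)` means `l ≤ r`, so expansion by `r⁻¹` stays in the cone. -/
theorem IsCone.exists_tentDirection (hC : IsCone K) :
    ∃ (θ : EuclideanSpace ℝ (Fin n)) (a d : ℝ), ‖θ‖ = 1 ∧ a < d ∧ TentDirection K θ a a d := by
  obtain ⟨H, ⟨⟨x₀, hx₀⟩, hfin⟩, B, q, hB, hq, hK⟩ := hC
  have hne : H.directionᗮ ≠ ⊥ := by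
    intro hbot
    have := Submodule.finrank_add_finrank_orthogonal H.direction
    rw [hbot, finrank_bot, finrank_euclideanSpace_fin] at this
    omega
  obtain ⟨w, hw, hw0⟩ := Submodule.exists_mem_ne_zero_of_ne_bot hne
  have hle : H.direction ≤ (ℝ ∙ w)ᗮ := by
    rw [Submodule.le_orthogonal_iff_le_orthogonal, Submodule.span_singleton_le_iff_mem]
    exact hw
  have heq : H.direction = (ℝ ∙ w)ᗮ := by
    refine Submodule.eq_of_le_of_finrank_eq hle ?_
    have h1 := Submodule.finrank_add_finrank_orthogonal (ℝ ∙ w)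
    rw [finrank_span_singleton hw0, finrank_euclideanSpace_fin] at h1
    omega
  have hqw : (inner ℝ (q - x₀) w : ℝ) ≠ 0 := by
    intro h0
    apply hq
    rw [← AffineSubspace.vsub_right_mem_direction_iff_mem hx₀, heq,
      Submodule.mem_orthogonal_singleton_iff_inner_left]
    exact h0
  obtain ⟨θ, hθ, hθq, hθB⟩ : ∃ θ : EuclideanSpace ℝ (Fin n), ‖θ‖ = 1 ∧
      (inner ℝ x₀ θ : ℝ) < inner ℝ q θ ∧ ∀ y ∈ B, (inner ℝ y θ : ℝ) = inner ℝ x₀ θ := by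
    -- The sign orients the normal from the base to the apex.
    refine ⟨(SignType.sign (inner ℝ (q - x₀) w : ℝ) : ℝ) • ‖w‖⁻¹ • w, ?_, ?_, fun y hy => ?_⟩
    · have hwn : ‖w‖ ≠ 0 := norm_ne_zero_iff.2 hw0
      rw [norm_smul, norm_smul, norm_inv, norm_norm, inv_mul_cancel₀ hwn, mul_one]
      rcases hqw.lt_or_gt with h | h <;> simp [h]
    · rw [← sub_pos, ← inner_sub_left, inner_smul_right, inner_smul_right]
      have h1 : 0 < (SignType.sign (inner ℝ (q - x₀) w : ℝ) : ℝ) * inner ℝ (q - x₀) w := by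
        rw [sign_mul_self]; exact abs_pos.2 hqw
      have h2 : 0 < ‖w‖⁻¹ := inv_pos.2 (norm_pos_iff.2 hw0)
      rw [mul_left_comm]
      exact mul_pos h2 h1
    · have : (inner ℝ (y - x₀) w : ℝ) = 0 := by
        have hd : y - x₀ ∈ H.direction := AffineSubspace.vsub_mem_direction (hB hy) hx₀
        rw [heq, Submodule.mem_orthogonal_singleton_iff_inner_left] at hd
        exact hd
      rw [← sub_eq_zero, ← inner_sub_left, inner_smul_right, inner_smul_right, this]
      simp
  set a : ℝ := inner ℝ x₀ θ with ha
  set d : ℝ := inner ℝ q θ with hd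
  have hlin : IsLinearMap ℝ fun x : EuclideanSpace ℝ (Fin n) => (inner ℝ x θ : ℝ) :=
    ⟨fun x y => inner_add_left _ _ _, fun c x => by simp [inner_smul_left]⟩
  have hBa : ∀ y ∈ convexHull ℝ B, (inner ℝ y θ : ℝ) = a := fun y hy =>
    convexHull_min (s := B) (t := {y | (inner ℝ y θ : ℝ) = a}) hθB
      (convex_hyperplane hlin a) hy
  have hqK : q ∈ K := by rw [hK]; exact subset_convexHull ℝ _ (Set.mem_insert _ _)
  have hBK : ∀ y ∈ convexHull ℝ B, y ∈ K := fun y hy => by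
    rw [hK]; exact convexHull_mono (Set.subset_insert _ _) hy
  have hKc : Convex ℝ K := by rw [hK]; exact convex_convexHull ℝ _
  have hrep : ∀ x ∈ K, x = q ∨ ∃ y ∈ convexHull ℝ B, ∃ l : ℝ, 0 ≤ l ∧ l ≤ 1 ∧
      x = q + l • (y - q) := by
    intro x hx
    rcases B.eq_empty_or_nonempty with rfl | hBn
    · left; simpa [hK] using hx
    · right
      rw [hK, convexHull_insert hBn, mem_convexJoin] at hx
      obtain ⟨q', hq', y, hy, hxs⟩ := hx
      rw [Set.mem_singleton_iff] at hq'
      subst hq'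
      rw [segment_eq_image'] at hxs
      obtain ⟨l, hl, rfl⟩ := hxs
      exact ⟨y, hy, l, hl.1, hl.2, rfl⟩
  have hval : ∀ y ∈ convexHull ℝ B, ∀ l : ℝ, (inner ℝ (q + l • (y - q)) θ : ℝ) =
      d + l * (a - d) := by
    intro y hy l
    rw [inner_add_left, inner_smul_left, inner_sub_left, hBa y hy]
    simp [hd]
  refine ⟨θ, a, d, hθ, hθq, le_rfl, hθq.le, fun x hx => ?_, fun x hx => ?_,
    fun hlt => absurd hlt (lt_irrefl a), fun _ => ⟨q, hqK, rfl, fun r hr hr1 x hx hxr => ?_⟩⟩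
  · rcases hrep x hx with rfl | ⟨y, hy, l, hl0, hl1, rfl⟩
    · exact hθq.le
    · rw [hval y hy]; nlinarith
  · rcases hrep x hx with rfl | ⟨y, hy, l, hl0, hl1, rfl⟩
    · exact le_rfl
    · rw [hval y hy]; nlinarith
  · rcases hrep x hx with rfl | ⟨y, hy, l, hl0, hl1, rfl⟩
    · simpa using hx
    · rw [hval y hy] at hxr
      have hlr : l ≤ r := by
        by_contra hcon
        nlinarith
      have h1 : r⁻¹ * l ≤ 1 := by rw [inv_mul_le_iff₀ hr]; linarith
      have h2 : 0 ≤ r⁻¹ * l := by positivity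
      have := hKc hqK (hBK y hy) (show 0 ≤ 1 - r⁻¹ * l by linarith) h2 (by ring)
      convert this using 1
      rw [add_sub_cancel_left, smul_smul, smul_sub, sub_smul, one_smul]
      abel

end

/-! ### Simplices: directions with every possible third moment. -/

section
variable {p : ℕ} {Δ K : Set (EuclideanSpace ℝ (Fin (p + 1)))}

theorem IsSimplex.exists_affineBasis (h : IsSimplex Δ) :
    ∃ B : AffineBasis (Fin (p + 2)) ℝ (EuclideanSpace ℝ (Fin (p + 1))),
      Δ = convexHull ℝ (Set.range B) := by
  obtain ⟨v, hv, rfl⟩ := h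
  exact ⟨⟨v, hv, (hv.affineSpan_eq_top_iff_card_eq_finrank_add_one).2 (by simp)⟩, rfl⟩

theorem IsSimplex.isConvexBody (h : IsSimplex Δ) : IsConvexBody Δ := by
  obtain ⟨B, rfl⟩ := h.exists_affineBasis
  exact ⟨convex_convexHull ℝ _, (Set.finite_range B).isCompact_convexHull ℝ,
    interior_convexHull_nonempty_iff_affineSpan_eq_top.2 B.tot⟩

/-- A path of directions along which the marginals of a simplex are tents, connecting the inner
normal of a facet to the outer normal of another one. -/
theorem IsSimplex.exists_path (h : IsSimplex Δ) :
    ∃ θ : ℝ → EuclideanSpace ℝ (Fin (p + 1)), Continuous θ ∧ (∀ s, ‖θ s‖ = 1) ∧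
      (∀ s ∈ Set.Icc (0 : ℝ) 1, ∃ a b d, TentDirection Δ (θ s) a b d) ∧
      (∃ b d, b < d ∧ TentDirection Δ (θ 0) b b d) ∧
      ∃ b d, b < d ∧ TentDirection Δ (-θ 1) b b d := by
  obtain ⟨B, hB⟩ := h.exists_affineBasis
  have hmem : ∀ x, x ∈ Δ ↔ ∀ i, 0 ≤ B.coord i x := by
    intro x
    rw [hB, B.convexHull_eq_nonneg_coord]
    rfl
  have hgrad : ∀ i, ∃ (u : EuclideanSpace ℝ (Fin (p + 1))) (k : ℝ), ∀ x,
      (inner ℝ x u : ℝ) = B.coord i x - k := by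
    intro i
    refine ⟨(InnerProductSpace.toDual ℝ _).symm
      (LinearMap.toContinuousLinearMap (B.coord i).linear), B.coord i 0, fun x => ?_⟩
    rw [real_inner_comm, InnerProductSpace.toDual_symm_apply, LinearMap.coe_toContinuousLinearMap']
    have := (B.coord i).linearMap_vsub x 0
    simpa using this
  obtain ⟨u₀, k₀, hu₀⟩ := hgrad 0
  obtain ⟨u₁, k₁, hu₁⟩ := hgrad 1
  have h01 : (0 : Fin (p + 2)) ≠ 1 := by simp
  -- `u₀` and `u₁` are gradients of barycentric coordinates. Up to the constant `κ s`, the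
  -- functional of `w s` is `1 - s` at the vertex `B 1`, `-s` at `B 0` and `0` at all other
  -- vertices. So the simplex is a double cone with apexes `B 0` and `B 1`, and a cone at `s = 0`
  -- and `s = 1`.
  set w : ℝ → EuclideanSpace ℝ (Fin (p + 1)) := fun s => (1 - s) • u₁ - s • u₀ with hw
  set κ : ℝ → ℝ := fun s => -(1 - s) * k₁ + s * k₀ with hκ
  have hin : ∀ s x, (inner ℝ x (w s) : ℝ) =
      (1 - s) * B.coord 1 x - s * B.coord 0 x + κ s := by
    intro s x
    rw [hw, inner_sub_right, inner_smul_right, inner_smul_right, hu₀, hu₁]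
    simp only [hκ]
    ring
  -- The values at `B 1` and `B 0` differ by 1.
  have hw0 : ∀ s, w s ≠ 0 := by
    intro s h0
    have e1 := hin s (B 1)
    have e0 := hin s (B 0)
    rw [h0] at e1 e0
    simp only [inner_zero_right, AffineBasis.coord_apply_eq, B.coord_apply_ne h01,
      B.coord_apply_ne h01.symm] at e1 e0
    linarith
  have hm : ∀ s, 0 < ‖w s‖⁻¹ := fun s => inv_pos.2 (norm_pos_iff.2 (hw0 s))
  have hin' : ∀ s x, (inner ℝ x (‖w s‖⁻¹ • w s) : ℝ) =
      ‖w s‖⁻¹ * ((1 - s) * B.coord 1 x - s * B.coord 0 x + κ s) := fun s x => by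
    rw [inner_smul_right, hin]
  have hle1 : ∀ x ∈ Δ, ∀ i, B.coord i x ≤ 1 := by
    intro x hx i
    rw [← B.sum_coord_apply_eq_one x]
    exact Finset.single_le_sum (fun j _ => (hmem x).1 hx j) (Finset.mem_univ i)
  have hvert : ∀ i, B i ∈ Δ := fun i => by
    rw [hB]; exact subset_convexHull ℝ _ ⟨i, rfl⟩
  -- The corner `{1 - r ≤ B.coord i}` of the simplex is its homothetic copy with centre `B i` and
  -- ratio `r`.
  have hhom : ∀ i x (r : ℝ), x ∈ Δ → 0 < r → 1 - r ≤ B.coord i x →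
      B i + r⁻¹ • (x - B i) ∈ Δ := by
    intro i x r hx hr hxr
    rw [hmem]
    intro j
    have e : B i + r⁻¹ • (x - B i) = AffineMap.lineMap (B i) x r⁻¹ := by
      rw [AffineMap.lineMap_apply, vsub_eq_sub, vadd_eq_add]
      exact add_comm _ _
    rw [e, AffineMap.apply_lineMap, AffineMap.lineMap_apply_module']
    simp only [smul_eq_mul]
    have hx0 := (hmem x).1 hx j
    by_cases hj : j = i
    · subst hj
      rw [B.coord_apply_eq]
      have : 0 ≤ r⁻¹ * (B.coord j x - (1 - r)) := mul_nonneg (inv_pos.2 hr).le (by linarith)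
      have e2 : r⁻¹ * (B.coord j x - 1) + 1 = r⁻¹ * (B.coord j x - (1 - r)) := by
        field_simp; ring
      rw [e2]; exact this
    · rw [B.coord_apply_ne hj, sub_zero, add_zero]
      exact mul_nonneg (inv_pos.2 hr).le hx0
  have htent : ∀ s ∈ Set.Icc (0 : ℝ) 1, TentDirection Δ (‖w s‖⁻¹ • w s)
      (‖w s‖⁻¹ * (κ s - s)) (‖w s‖⁻¹ * κ s) (‖w s‖⁻¹ * (κ s + (1 - s))) := by
    intro s hs
    have hm' := hm s
    refine ⟨?_, ?_, fun x hx => ?_, fun x hx => ?_, fun hlt => ?_, fun hlt => ?_⟩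
    · exact mul_le_mul_of_nonneg_left (by linarith [hs.1]) hm'.le
    · exact mul_le_mul_of_nonneg_left (by linarith [hs.2]) hm'.le
    · rw [hin']
      refine mul_le_mul_of_nonneg_left ?_ hm'.le
      nlinarith [hs.1, hs.2, hle1 x hx 0, (hmem x).1 hx 1]
    · rw [hin']
      refine mul_le_mul_of_nonneg_left ?_ hm'.le
      nlinarith [hs.1, hs.2, hle1 x hx 1, (hmem x).1 hx 0]
    · have hs0 : 0 < s := by
        have := lt_of_mul_lt_mul_left hlt hm'.le
        linarith
      refine ⟨B 0, hvert 0, ?_, fun r hr hr1 x hx hxr => hhom 0 x r hx hr ?_⟩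
      · rw [hin', B.coord_apply_eq, B.coord_apply_ne h01.symm]; ring
      · rw [hin'] at hxr
        have h1 : (1 - s) * B.coord 1 x - s * B.coord 0 x + κ s ≤ κ s - s + r * s := by
          refine le_of_mul_le_mul_left (hxr.trans (le_of_eq ?_)) hm'
          ring
        have h2 : 0 ≤ (1 - s) * B.coord 1 x :=
          mul_nonneg (by linarith [hs.2]) ((hmem x).1 hx 1)
        have h3 : s * (1 - r) ≤ s * B.coord 0 x := by linarith
        exact le_of_mul_le_mul_left h3 hs0
    · have hs0 : 0 < 1 - s := by
        have := lt_of_mul_lt_mul_left hlt hm'.le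
        linarith
      refine ⟨B 1, hvert 1, ?_, fun r hr hr1 x hx hxr => hhom 1 x r hx hr ?_⟩
      · rw [hin', B.coord_apply_eq, B.coord_apply_ne h01]; ring
      · rw [hin'] at hxr
        have h1 : κ s + (1 - s) - r * (1 - s) ≤
            (1 - s) * B.coord 1 x - s * B.coord 0 x + κ s := by
          refine le_of_mul_le_mul_left ((le_of_eq ?_).trans hxr) hm'
          ring
        have h2 : 0 ≤ s * B.coord 0 x :=
          mul_nonneg hs.1 ((hmem x).1 hx 0)
        have h3 : (1 - s) * (1 - r) ≤ (1 - s) * B.coord 1 x := by linarith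
        exact le_of_mul_le_mul_left h3 hs0
  have hwc : Continuous w := by fun_prop
  refine ⟨fun s => ‖w s‖⁻¹ • w s, ?_, fun s => ?_, fun s hs => ⟨_, _, _, htent s hs⟩, ?_, ?_⟩
  · exact (hwc.norm.inv₀ fun s => norm_ne_zero_iff.2 (hw0 s)).smul hwc
  · rw [norm_smul, norm_inv, norm_norm, inv_mul_cancel₀ (norm_ne_zero_iff.2 (hw0 s))]
  · have := htent 0 (by simp)
    simp only [sub_zero] at this
    exact ⟨_, _, mul_lt_mul_of_pos_left (by linarith) (hm 0), this⟩
  · have := (htent 1 (by simp)).neg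
    simp only [sub_self, add_zero] at this
    exact ⟨_, _, neg_lt_neg (mul_lt_mul_of_pos_left (by linarith) (hm 1)), this⟩

theorem iteratedDeriv_pow_self (k : ℕ) (x : ℝ) :
    iteratedDeriv k (fun t : ℝ => t ^ k) x = k.factorial := by
  have h := iteratedDeriv_polynomial_eval (Polynomial.X ^ k) k
  simp only [Polynomial.eval_pow, Polynomial.eval_X] at h
  rw [h]
  exact (iterate_derivative_eval_of_natDegree_le _ _ (by simp) x).trans (by simp)

theorem marginalExp_neg_cube {n : ℕ} (K : Set (EuclideanSpace ℝ (Fin n)))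
    (θ : EuclideanSpace ℝ (Fin n)) :
    marginalExp K (fun t => t ^ 3) (-θ) = -marginalExp K (fun t => t ^ 3) θ := by
  unfold marginalExp
  rw [← integral_neg]
  refine integral_congr_ae (Filter.Eventually.of_forall fun x => ?_)
  simp only [inner_neg_right]
  ring

/-- Every marginal of an isotropic body is dominated, with respect to functions with positive
fourth derivative, by a marginal of an isotropic simplex. -/
theorem IsSimplex.exists_marginalExp_le (hK : IsConvexBody K) (hKi : IsIsotropic K)
    (hΔ : IsSimplex Δ) (hΔi : IsIsotropic Δ) {θ : EuclideanSpace ℝ (Fin (p + 1))} (hθ : ‖θ‖ = 1)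
    {φ : ℝ → ℝ} (hφ : ContDiff ℝ 4 φ) (hpos : ∀ x, 0 < iteratedDeriv 4 φ x) :
    ∃ η : EuclideanSpace ℝ (Fin (p + 1)), ‖η‖ = 1 ∧ marginalExp K φ θ ≤ marginalExp Δ φ η := by
  obtain ⟨η, hηc, hη, htent, ⟨b₀, d₀, _, h₀⟩, ⟨b₁, d₁, _, h₁⟩⟩ := hΔ.exists_path
  have hΔb := hΔ.isConvexBody
  have hc3 : ContDiff ℝ 3 fun t : ℝ => t ^ 3 := contDiff_id.pow 3
  have hp3 : ∀ x : ℝ, 0 < iteratedDeriv 3 (fun t : ℝ => t ^ 3) x := by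
    intro x
    rw [iteratedDeriv_pow_self]
    positivity
  -- The cube is itself an admissible function for `k = 3`, so the third moment at `η 0` is an upper
  -- bound. Since the third moment is odd in the direction, the cone in direction `-η 1` gives the
  -- lower bound.
  have hup := (h₀.marginalExp_le_cone hK hKi hΔb hΔi hθ (hη 0) hc3 hp3).1
  have hlo := (h₁.marginalExp_le_cone hK hKi hΔb hΔi (θ := -θ) (by rwa [norm_neg])
    (by rw [norm_neg]; exact hη 1) hc3 hp3).1
  rw [marginalExp_neg_cube, marginalExp_neg_cube, neg_le_neg_iff] at hlo
  have hcont : ContinuousOn (fun s => marginalExp Δ (fun t => t ^ 3) (η s)) (Set.Icc 0 1) :=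
    ((continuous_marginalExp hΔb (continuous_pow 3)).comp hηc).continuousOn
  obtain ⟨s, hs, hs3⟩ := intermediate_value_Icc' zero_le_one hcont ⟨hlo, hup⟩
  obtain ⟨a, b, d, ht⟩ := htent s hs
  exact ⟨η s, hη s, ht.marginalExp_le hK hKi hΔb hΔi hθ (hη s) hs3.symm hφ hpos⟩

end

/-! ### The comparison of the maxima. -/

section
variable {p : ℕ} {K Δ : Set (EuclideanSpace ℝ (Fin (p + 1)))} {φ : ℝ → ℝ}

theorem TentDirection.isMaxMarginal (hΔ : IsConvexBody Δ) (hΔi : IsIsotropic Δ)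
    {η : EuclideanSpace ℝ (Fin (p + 1))} (hη : ‖η‖ = 1) {a d : ℝ} (h : TentDirection Δ η a a d)
    (hφ : ContDiff ℝ 3 φ) (hpos : ∀ x, 0 < iteratedDeriv 3 φ x) :
    IsMaxMarginal Δ φ (marginalExp Δ φ η) := by
  refine ⟨⟨η, by simpa using hη, rfl⟩, ?_⟩
  rintro _ ⟨θ, hθ, rfl⟩
  exact (h.marginalExp_le_cone hΔ hΔi hΔ hΔi (by simpa using hθ) hη hφ hpos).1

/-- The maximum for the simplex is attained at the cone direction `η 0`, so equality at any
direction of `K` makes `K` a cone along it. If `K` is a cone, the comparison with `K` as the cone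
and `Δ` as the body gives the reverse inequality. -/
theorem exists_max_le_of_third_deriv_pos (hK : IsConvexBody K) (hKi : IsIsotropic K)
    (hΔ : IsSimplex Δ) (hΔi : IsIsotropic Δ) (hφ : ContDiff ℝ 3 φ)
    (hpos : ∀ x, 0 < iteratedDeriv 3 φ x) :
    ∃ M N : ℝ, IsMaxMarginal K φ M ∧ IsMaxMarginal Δ φ N ∧ M ≤ N ∧ (M = N ↔ IsCone K) ∧
      (IsCone K → ∀ θ ∈ Metric.sphere (0 : EuclideanSpace ℝ (Fin (p + 1))) 1,
        marginalExp K φ θ = M → ∃ H : AffineSubspace ℝ (EuclideanSpace ℝ (Fin (p + 1))),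
          IsConeWithBaseIn K H ∧ θ ∈ H.directionᗮ) := by
  obtain ⟨η, -, hη, -, ⟨a, d, had, ht⟩, -⟩ := hΔ.exists_path
  have hΔb := hΔ.isConvexBody
  obtain ⟨θ, hθ, hmax⟩ := exists_isMaxMarginal (Nat.le_add_left 1 p) hK hφ.continuous
  have hcmp : ∀ ζ : EuclideanSpace ℝ (Fin (p + 1)), ‖ζ‖ = 1 → _ := fun ζ hζ =>
    ht.marginalExp_le_cone hK hKi hΔb hΔi hζ (hη 0) hφ hpos
  have hcone : ∀ ζ : EuclideanSpace ℝ (Fin (p + 1)), ‖ζ‖ = 1 →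
      marginalExp K φ ζ = marginalExp Δ φ (η 0) →
      ∃ H : AffineSubspace ℝ (EuclideanSpace ℝ (Fin (p + 1))),
        IsConeWithBaseIn K H ∧ ζ ∈ H.directionᗮ := fun ζ hζ he =>
    (ht.of_map_eq hK hΔb had ((hcmp ζ hζ).2 he)).isConeWithBaseIn hK hζ had
  have hiff : marginalExp K φ θ = marginalExp Δ φ (η 0) ↔ IsCone K := by
    constructor
    · intro he
      obtain ⟨H, hH, -⟩ := hcone θ hθ he
      exact ⟨H, hH⟩
    · intro hC
      obtain ⟨ζ, a', d', hζ, had', ht'⟩ := hC.exists_tentDirection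
      refine le_antisymm (hcmp θ hθ).1 ?_
      exact (ht'.marginalExp_le_cone hΔb hΔi hK hKi (hη 0) hζ hφ hpos).1.trans
        (hmax.2 ⟨ζ, by simpa using hζ, rfl⟩)
  exact ⟨_, _, hmax, ht.isMaxMarginal hΔb hΔi (hη 0) hφ hpos, (hcmp θ hθ).1, hiff,
    fun hC ζ hζ he => hcone ζ (by simpa using hζ) (he.trans (hiff.2 hC))⟩

theorem exists_max_le_of_fourth_deriv_pos (hK : IsConvexBody K) (hKi : IsIsotropic K)
    (hΔ : IsSimplex Δ) (hΔi : IsIsotropic Δ) (hφ : ContDiff ℝ 4 φ)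
    (hpos : ∀ x, 0 < iteratedDeriv 4 φ x) :
    ∃ M N : ℝ, IsMaxMarginal K φ M ∧ IsMaxMarginal Δ φ N ∧ M ≤ N := by
  obtain ⟨θ, hθ, hmax⟩ := exists_isMaxMarginal (Nat.le_add_left 1 p) hK hφ.continuous
  obtain ⟨η, hη, hmaxΔ⟩ :=
    exists_isMaxMarginal (Nat.le_add_left 1 p) hΔ.isConvexBody hφ.continuous
  obtain ⟨ζ, hζ, hle⟩ := hΔ.exists_marginalExp_le hK hKi hΔi hθ hφ hpos
  exact ⟨_, _, hmax, hmaxΔ, hle.trans (hmaxΔ.2 ⟨ζ, by simpa using hζ, rfl⟩)⟩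

end

/-! ### The planar example for `k = 4`: square and regular triangle. -/

/-- The region of the plane symmetric about the first axis, of half-width `ℓ t` over
`t ∈ [α, β]`. -/
def symmetricRegion (α β : ℝ) (ℓ : ℝ → ℝ) : Set (EuclideanSpace ℝ (Fin 2)) :=
  {x | x 0 ∈ Set.Icc α β ∧ |x 1| ≤ ℓ (x 0)}

theorem setIntegral_symmetricRegion {α β : ℝ} (hαβ : α ≤ β) {ℓ : ℝ → ℝ} (hℓ : Continuous ℓ)
    (hℓ0 : ∀ t ∈ Set.Icc α β, 0 ≤ ℓ t) (i j : ℕ) :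
    ∫ x in symmetricRegion α β ℓ, x 0 ^ i * x 1 ^ j =
      ∫ t in α..β, t ^ i * ((ℓ t ^ (j + 1) - (-ℓ t) ^ (j + 1)) / (j + 1)) := by
  set S : Set (ℝ × ℝ) := {w | w.1 ∈ Set.Icc α β ∧ |w.2| ≤ ℓ w.1} with hS
  have hSc : IsClosed S :=
    (isClosed_Icc.preimage continuous_fst).inter
      (isClosed_le continuous_snd.abs (hℓ.comp continuous_fst))
  have hScomp : IsCompact S := by
    obtain ⟨R, hR⟩ := (isCompact_Icc (a := α) (b := β)).exists_bound_of_continuousOn hℓ.continuousOn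
    refine ((isCompact_Icc (a := α) (b := β)).prod (isCompact_Icc (a := -R) (b := R))).of_isClosed_subset hSc ?_
    rintro ⟨t, y⟩ ⟨ht, hy⟩
    refine ⟨ht, abs_le.1 (hy.trans ((le_abs_self _).trans (hR t ht)))⟩
  set e := (MeasurableEquiv.toLp 2 (Fin 2 → ℝ)).symm.trans
    (MeasurableEquiv.finTwoArrow (α := ℝ)) with he
  have hmp : MeasurePreserving e volume volume :=
    (volume_preserving_finTwoArrow ℝ).comp
      (EuclideanSpace.volume_preserving_symm_measurableEquiv_toLp (Fin 2))
  have hpre : symmetricRegion α β ℓ = e ⁻¹' S := rfl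
  have h1 := hmp.setIntegral_preimage_emb e.measurableEmbedding
    (fun w : ℝ × ℝ => w.1 ^ i * w.2 ^ j) S
  rw [hpre]
  refine Eq.trans h1 ?_
  have hint : Integrable (S.indicator fun w : ℝ × ℝ => w.1 ^ i * w.2 ^ j)
      (volume.prod volume) := by
    rw [integrable_indicator_iff hSc.measurableSet]
    exact ContinuousOn.integrableOn_compact (μ := volume) hScomp (by fun_prop)
  rw [← integral_indicator hSc.measurableSet, Measure.volume_eq_prod, integral_prod _ hint,
    intervalIntegral.integral_of_le hαβ, ← integral_Icc_eq_integral_Ioc,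
    ← integral_indicator measurableSet_Icc]
  refine integral_congr_ae (Filter.Eventually.of_forall fun t => ?_)
  by_cases ht : t ∈ Set.Icc α β
  · have e1 : (fun y => S.indicator (fun w : ℝ × ℝ => w.1 ^ i * w.2 ^ j) (t, y)) =
        (Set.Icc (-ℓ t) (ℓ t)).indicator fun y => t ^ i * y ^ j := by
      ext y
      have hiff : (t, y) ∈ S ↔ y ∈ Set.Icc (-ℓ t) (ℓ t) := by
        simp only [hS, Set.mem_ofPred_eq, abs_le, Set.mem_Icc]
        exact and_iff_right ht
      by_cases hy : y ∈ Set.Icc (-ℓ t) (ℓ t)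
      · rw [Set.indicator_of_mem hy, Set.indicator_of_mem (hiff.2 hy)]
      · rw [Set.indicator_of_notMem hy, Set.indicator_of_notMem (fun h => hy (hiff.1 h))]
    simp only [Set.indicator_of_mem ht]
    rw [e1, integral_indicator measurableSet_Icc, integral_Icc_eq_integral_Ioc,
      ← intervalIntegral.integral_of_le (by linarith [hℓ0 t ht]),
      intervalIntegral.integral_const_mul, integral_pow]
  · have e1 : (fun y => S.indicator (fun w : ℝ × ℝ => w.1 ^ i * w.2 ^ j) (t, y)) = fun _ => 0 := by
      ext y
      exact Set.indicator_of_notMem (fun h => ht h.1) _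
    simp only [Set.indicator_of_notMem ht]
    rw [e1, integral_zero]

theorem integral_uniformLaw_eq_div {n : ℕ} {K : Set (EuclideanSpace ℝ (Fin n))}
    (h : EuclideanSpace ℝ (Fin n) → ℝ) :
    ∫ x, h x ∂(uniformLaw K) = (∫ x in K, h x) / (volume K).toReal := by
  unfold uniformLaw ProbabilityTheory.cond
  rw [integral_smul_measure, ENNReal.toReal_inv, smul_eq_mul, inv_mul_eq_div]

theorem integral_uniformLaw_symmetricRegion {α β : ℝ} (hαβ : α ≤ β) {ℓ : ℝ → ℝ}
    (hℓ : Continuous ℓ) (hℓ0 : ∀ t ∈ Set.Icc α β, 0 ≤ ℓ t) (i j : ℕ) :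
    ∫ x, x 0 ^ i * x 1 ^ j ∂(uniformLaw (symmetricRegion α β ℓ)) =
      (∫ t in α..β, t ^ i * ((ℓ t ^ (j + 1) - (-ℓ t) ^ (j + 1)) / (j + 1))) /
        ∫ t in α..β, 2 * ℓ t := by
  rw [integral_uniformLaw_eq_div, setIntegral_symmetricRegion hαβ hℓ hℓ0]
  congr 1
  have h := setIntegral_symmetricRegion hαβ hℓ hℓ0 0 0
  simp only [pow_zero, one_mul, mul_one, integral_const, smul_eq_mul, zero_add, pow_one,
    sub_neg_eq_add, Nat.cast_zero, div_one, ← two_mul, measureReal_restrict_apply_univ] at h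
  exact h

theorem isIsotropic_of_moments {K : Set (EuclideanSpace ℝ (Fin 2))}
    (h10 : ∫ x, x 0 ^ 1 * x 1 ^ 0 ∂(uniformLaw K) = 0)
    (h01 : ∫ x, x 0 ^ 0 * x 1 ^ 1 ∂(uniformLaw K) = 0)
    (h20 : ∫ x, x 0 ^ 2 * x 1 ^ 0 ∂(uniformLaw K) = 1)
    (h11 : ∫ x, x 0 ^ 1 * x 1 ^ 1 ∂(uniformLaw K) = 0)
    (h02 : ∫ x, x 0 ^ 0 * x 1 ^ 2 ∂(uniformLaw K) = 1) : IsIsotropic K := by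
  simp only [pow_zero, mul_one, one_mul, pow_one, sq] at *
  constructor
  · intro i
    fin_cases i <;> simpa
  · intro i j
    fin_cases i <;> fin_cases j <;> simp_all [mul_comm]

theorem marginalExp_pow {K : Set (EuclideanSpace ℝ (Fin 2))} (hK : IsConvexBody K) (k : ℕ)
    (θ : EuclideanSpace ℝ (Fin 2)) :
    marginalExp K (fun t => t ^ k) θ = ∑ m ∈ Finset.range (k + 1),
      θ 0 ^ m * θ 1 ^ (k - m) * k.choose m * ∫ x, x 0 ^ m * x 1 ^ (k - m) ∂(uniformLaw K) := by
  unfold marginalExp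
  have e : ∀ x : EuclideanSpace ℝ (Fin 2), (inner ℝ x θ : ℝ) ^ k = ∑ m ∈ Finset.range (k + 1),
      θ 0 ^ m * θ 1 ^ (k - m) * k.choose m * (x 0 ^ m * x 1 ^ (k - m)) := by
    intro x
    rw [PiLp.inner_apply, Fin.sum_univ_two, add_pow]
    refine Finset.sum_congr rfl fun m _ => ?_
    simp only [RCLike.inner_apply, conj_trivial, mul_pow]
    ring
  simp_rw [e]
  rw [integral_finsetSum _ fun m _ => hK.integrable (by fun_prop)]
  exact Finset.sum_congr rfl fun m _ => integral_const_mul _ _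

/-- Gives the moments of the triangle after the substitution `u = 2 * √2 - t`, the distance from the
level of the apex. -/
theorem integral_sub_pow_mul_pow (c e : ℝ) (i k : ℕ) :
    ∫ u in (0 : ℝ)..c, (e - u) ^ i * u ^ k = ∑ m ∈ Finset.range (i + 1),
      (-1) ^ m * e ^ (i - m) * i.choose m * (c ^ (k + m + 1) / (k + m + 1)) := by
  have h : ∀ u : ℝ, (e - u) ^ i * u ^ k = ∑ m ∈ Finset.range (i + 1),
      (-1) ^ m * e ^ (i - m) * i.choose m * u ^ (k + m) := by
    intro u
    rw [sub_eq_neg_add, add_pow, Finset.sum_mul]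
    refine Finset.sum_congr rfl fun m _ => ?_
    rw [neg_pow u m]
    ring
  simp_rw [h]
  rw [intervalIntegral.integral_finsetSum fun m _ => by
    exact (Continuous.intervalIntegrable (by fun_prop) _ _)]
  refine Finset.sum_congr rfl fun m _ => ?_
  rw [intervalIntegral.integral_const_mul, integral_pow]
  simp

/-- The isotropic square. -/
def isotropicSquare : Set (EuclideanSpace ℝ (Fin 2)) :=
  -- The uniform law on `[-c, c]` has variance `c ^ 2 / 3`.
  symmetricRegion (-√3) √3 fun _ => √3

theorem isConvexBody_isotropicSquare : IsConvexBody isotropicSquare := by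
  have hw : 0 < √3 := by positivity
  have e : isotropicSquare = EuclideanSpace.equiv (Fin 2) ℝ ⁻¹'
      Set.Icc (fun _ => -√3) (fun _ => √3) := by
    ext x
    simp [isotropicSquare, symmetricRegion, Pi.le_def, Fin.forall_fin_two, abs_le]
    tauto
  refine ⟨?_, ?_, ?_⟩
  · rw [e]
    exact (convex_Icc _ _).linear_preimage (EuclideanSpace.equiv (Fin 2) ℝ).toLinearMap
  · rw [e]
    exact (EuclideanSpace.equiv (Fin 2) ℝ).toHomeomorph.isCompact_preimage.2 isCompact_Icc
  · refine ⟨0, mem_interior.2 ⟨{x | (-√3 < x 0 ∧ x 0 < √3) ∧ (-√3 < x 1 ∧ x 1 < √3)}, ?_, ?_, ?_⟩⟩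
    · rintro x ⟨⟨h1, h2⟩, h3, h4⟩
      exact ⟨⟨h1.le, h2.le⟩, abs_le.2 ⟨h3.le, h4.le⟩⟩
    · refine IsOpen.and (IsOpen.and ?_ ?_) (IsOpen.and ?_ ?_) <;>
        exact isOpen_lt (by fun_prop) (by fun_prop)
    · simp

theorem integral_isotropicSquare (i j : ℕ) :
    ∫ x, x 0 ^ i * x 1 ^ j ∂(uniformLaw isotropicSquare) =
      ((√3 ^ (i + 1) - (-√3) ^ (i + 1)) / (i + 1)) * ((√3 ^ (j + 1) - (-√3) ^ (j + 1)) / (j + 1)) /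
        12 := by
  have hw : 0 < √3 := by positivity
  unfold isotropicSquare
  rw [integral_uniformLaw_symmetricRegion (by linarith) continuous_const (fun _ _ => hw.le),
    intervalIntegral.integral_mul_const, integral_pow, intervalIntegral.integral_const]
  congr 1
  have := Real.sq_sqrt (show (0 : ℝ) ≤ 3 by norm_num)
  simp only [smul_eq_mul]
  linear_combination 4 * this

theorem isIsotropic_isotropicSquare : IsIsotropic isotropicSquare := by
  have h3 : √3 ^ 2 = 3 := Real.sq_sqrt (by norm_num)
  have h4 : √3 ^ 4 = 9 := by rw [show √3 ^ 4 = (√3 ^ 2) ^ 2 by ring, h3]; norm_num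
  apply isIsotropic_of_moments <;> rw [integral_isotropicSquare] <;> ring_nf <;> norm_num [h4]

theorem marginalExp_isotropicSquare_cube (θ : EuclideanSpace ℝ (Fin 2)) :
    marginalExp isotropicSquare (fun t => t ^ 3) θ = 0 := by
  rw [marginalExp_pow isConvexBody_isotropicSquare]
  simp_rw [integral_isotropicSquare]
  norm_num [Finset.sum_range_succ]

theorem marginalExp_isotropicSquare_four (θ : EuclideanSpace ℝ (Fin 2)) :
    marginalExp isotropicSquare (fun t => t ^ 4) θ =
      9 / 5 * (θ 0 ^ 4 + θ 1 ^ 4) + 6 * (θ 0 ^ 2 * θ 1 ^ 2) := by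
  have h3 : √3 ^ 2 = 3 := Real.sq_sqrt (by norm_num)
  have h6 : √3 ^ 6 = 27 := by rw [show √3 ^ 6 = (√3 ^ 2) ^ 3 by ring, h3]; norm_num
  rw [marginalExp_pow isConvexBody_isotropicSquare]
  simp_rw [integral_isotropicSquare]
  simp only [Finset.sum_range_succ, Finset.sum_range_zero]
  norm_num [Nat.choose]
  ring_nf
  rw [h6]
  ring

/-- The isotropic regular triangle. -/
def isotropicTriangle : Set (EuclideanSpace ℝ (Fin 2)) :=
  -- Centroid at the origin and circumradius `2 * √2`; this size gives unit covariance.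
  symmetricRegion (-√2) (2 * √2) fun t => (2 * √2 - t) / √3

theorem isSimplex_isotropicTriangle : IsSimplex isotropicTriangle := by
  have ha : 0 < √2 := by positivity
  have hw : 0 < √3 := by positivity
  set v : Fin 3 → EuclideanSpace ℝ (Fin 2) :=
    ![!₂[2 * √2, 0], !₂[-√2, 3 * √2 / √3], !₂[-√2, -(3 * √2 / √3)]] with hv
  have hmem : ∀ x : EuclideanSpace ℝ (Fin 2), x ∈ isotropicTriangle ↔
      -√2 ≤ x 0 ∧ x 0 + √3 * x 1 ≤ 2 * √2 ∧ x 0 - √3 * x 1 ≤ 2 * √2 := by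
    intro x
    simp only [isotropicTriangle, symmetricRegion, Set.mem_ofPred_eq, Set.mem_Icc, abs_le]
    rw [le_div_iff₀ hw, ← neg_div, div_le_iff₀ hw]
    constructor
    · rintro ⟨⟨h1, h2⟩, h3, h4⟩
      exact ⟨h1, by linarith, by linarith⟩
    · rintro ⟨h1, h2, h3⟩
      exact ⟨⟨h1, by linarith⟩, by linarith, by linarith⟩
  refine ⟨v, ?_, Set.Subset.antisymm (fun x hx => ?_) (convexHull_min ?_ ?_)⟩
  · rw [affineIndependent_iff_of_fintype]
    intro c hc hcv
    rw [Finset.univ.weightedVSub_eq_linear_combination hc] at hcv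
    have e0 := congrArg (fun z : EuclideanSpace ℝ (Fin 2) => z 0) hcv
    have e1 := congrArg (fun z : EuclideanSpace ℝ (Fin 2) => z 1) hcv
    simp [hv, Fin.sum_univ_three] at e0 e1 hc
    have e0' : c 0 * 2 - c 1 - c 2 = 0 := by
      have : √2 * (c 0 * 2 - c 1 - c 2) = 0 := by linarith
      exact (mul_eq_zero.1 this).resolve_left ha.ne'
    have e1' : c 1 - c 2 = 0 := by
      have hb : 0 < 3 * √2 / √3 := by positivity
      have : 3 * √2 / √3 * (c 1 - c 2) = 0 := by linarith
      exact (mul_eq_zero.1 this).resolve_left hb.ne'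
    intro i
    fin_cases i <;> simp <;> linarith
  -- The three inequalities say that the barycentric coordinates of `x`, written out below, are
  -- non-negative.
  · obtain ⟨h1, h2, h3⟩ := (hmem x).1 hx
    have hsum : x = ∑ i, (![(x 0 + √2) / (3 * √2), (2 * √2 - x 0 + √3 * x 1) / (6 * √2),
        (2 * √2 - x 0 - √3 * x 1) / (6 * √2)] : Fin 3 → ℝ) i • v i := by
      ext i
      fin_cases i
      · simp [hv, Fin.sum_univ_three]
        field_simp
        ring
      · simp [hv, Fin.sum_univ_three]
        field_simp
        ring
    rw [hsum]
    refine (convex_convexHull ℝ _).sum_mem (fun i _ => ?_) ?_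
      fun i _ => subset_convexHull ℝ _ ⟨i, rfl⟩
    · fin_cases i
      · exact div_nonneg (by linarith) (by positivity)
      · exact div_nonneg (by linarith) (by positivity)
      · exact div_nonneg (by linarith) (by positivity)
    · simp [Fin.sum_univ_three]
      field_simp
      ring
  · rintro _ ⟨i, rfl⟩
    rw [hmem]
    fin_cases i <;> simp [hv] <;> field_simp <;> norm_num
  · intro x hx y hy α β hα hβ hαβ
    rw [hmem] at *
    simp only [PiLp.add_apply, PiLp.smul_apply, smul_eq_mul]
    refine ⟨?_, ?_, ?_⟩
    · nlinarith [hx.1, hy.1]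
    · nlinarith [hx.2.1, hy.2.1]
    · nlinarith [hx.2.2, hy.2.2]

theorem integral_isotropicTriangle (i j : ℕ) :
    ∫ x, x 0 ^ i * x 1 ^ j ∂(uniformLaw isotropicTriangle) =
      (1 - (-1) ^ (j + 1)) / (√3 ^ j * (j + 1)) * (∑ m ∈ Finset.range (i + 1),
        (-1) ^ m * (2 * √2) ^ (i - m) * i.choose m *
          ((3 * √2) ^ (j + 1 + m + 1) / ((j + 1 : ℕ) + m + 1))) / 18 := by
  have ha : 0 < √2 := by positivity
  have hw : 0 < √3 := by positivity
  have key : ∀ i j : ℕ, ∫ t in -√2..2 * √2, t ^ i *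
      ((((2 * √2 - t) / √3) ^ (j + 1) - (-((2 * √2 - t) / √3)) ^ (j + 1)) / (j + 1)) =
      (1 - (-1) ^ (j + 1)) / (√3 ^ (j + 1) * (j + 1)) * (∑ m ∈ Finset.range (i + 1),
        (-1) ^ m * (2 * √2) ^ (i - m) * i.choose m *
          ((3 * √2) ^ (j + 1 + m + 1) / ((j + 1 : ℕ) + m + 1))) := by
    intro i j
    rw [← integral_sub_pow_mul_pow, ← intervalIntegral.integral_const_mul]
    have h := intervalIntegral.integral_comp_sub_left (a := -√2) (b := 2 * √2)
      (fun u => (1 - (-1) ^ (j + 1)) / (√3 ^ (j + 1) * (j + 1)) *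
        ((2 * √2 - u) ^ i * u ^ (j + 1))) (2 * √2)
    rw [sub_self, show 2 * √2 - -√2 = 3 * √2 by ring] at h
    rw [← h]
    refine intervalIntegral.integral_congr fun t _ => ?_
    simp only [sub_sub_cancel]
    rw [neg_pow ((2 * √2 - t) / √3), div_pow]
    field_simp
  have h2 : √2 ^ 2 = 2 := Real.sq_sqrt (by norm_num)
  have hden : ∫ t in -√2..2 * √2, 2 * ((2 * √2 - t) / √3) = 18 / √3 := by
    have := key 0 0
    simp at this
    rw [← intervalIntegral.integral_congr (g := fun t => 2 * ((2 * √2 - t) / √3))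
      (f := fun t => (2 * √2 - t) / √3 + (2 * √2 - t) / √3) (fun t _ => by ring), this]
    field_simp
    nlinarith
  unfold isotropicTriangle
  rw [integral_uniformLaw_symmetricRegion (by linarith) (by fun_prop)
    (fun t ht => div_nonneg (by linarith [ht.2]) hw.le), key, hden, pow_succ (√3)]
  field_simp

theorem isIsotropic_isotropicTriangle : IsIsotropic isotropicTriangle := by
  have h2 : √2 ^ 2 = 2 := Real.sq_sqrt (by norm_num)
  have h4 : √2 ^ 4 = 4 := by rw [show √2 ^ 4 = (√2 ^ 2) ^ 2 by ring, h2]; norm_num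
  have h3 : √3 ^ 2 = 3 := Real.sq_sqrt (by norm_num)
  apply isIsotropic_of_moments <;> rw [integral_isotropicTriangle] <;>
    norm_num [Finset.sum_range_succ] <;> ring_nf <;> norm_num [h2, h3, h4]

theorem marginalExp_isotropicTriangle_cube_pos : 0 < marginalExp isotropicTriangle
    (fun t => t ^ 3) (EuclideanSpace.single 0 1) := by
  have h2 : √2 ^ 2 = 2 := Real.sq_sqrt (by norm_num)
  have h5 : √2 ^ 5 = 4 * √2 := by rw [show √2 ^ 5 = (√2 ^ 2) ^ 2 * √2 by ring, h2]; norm_num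
  rw [marginalExp_pow isSimplex_isotropicTriangle.isConvexBody]
  simp_rw [integral_isotropicTriangle]
  norm_num [Finset.sum_range_succ]
  ring_nf
  rw [h5]
  have : 0 < √2 := by positivity
  linarith

/-- A quartic form with the symmetries of a regular triangle is a multiple of `‖θ‖ ^ 4`, so every
direction attains the maximum. -/
theorem marginalExp_isotropicTriangle_four (θ : EuclideanSpace ℝ (Fin 2)) :
    marginalExp isotropicTriangle (fun t => t ^ 4) θ = 12 / 5 * (θ 0 ^ 2 + θ 1 ^ 2) ^ 2 := by
  have h2 : √2 ^ 2 = 2 := Real.sq_sqrt (by norm_num)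
  have h6 : √2 ^ 6 = 8 := by rw [show √2 ^ 6 = (√2 ^ 2) ^ 3 by ring, h2]; norm_num
  have h3 : √3 ^ 2 = 3 := Real.sq_sqrt (by norm_num)
  have h34 : √3 ^ 4 = 9 := by rw [show √3 ^ 4 = (√3 ^ 2) ^ 2 by ring, h3]; norm_num
  rw [marginalExp_pow isSimplex_isotropicTriangle.isConvexBody]
  simp_rw [integral_isotropicTriangle]
  norm_num [Finset.sum_range_succ, h3, h34, Nat.choose]
  ring_nf
  norm_num [h6]
  ring

/-- If the square were a cone, its third moment along the normal of the base would be at least that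
of the triangle along the first axis, which is positive. By central symmetry the third moments of
the square vanish. -/
theorem not_isCone_isotropicSquare : ¬ IsCone isotropicSquare := by
  intro hC
  obtain ⟨ζ, a, d, hζ, -, ht⟩ := hC.exists_tentDirection
  have hpos : ∀ x : ℝ, 0 < iteratedDeriv 3 (fun t : ℝ => t ^ 3) x := fun x => by
    rw [iteratedDeriv_pow_self]; positivity
  have h := (ht.marginalExp_le_cone (p := 1) isSimplex_isotropicTriangle.isConvexBody
    isIsotropic_isotropicTriangle isConvexBody_isotropicSquare isIsotropic_isotropicSquare
    (θ := EuclideanSpace.single 0 1) (by simp) hζ (contDiff_id.pow 3) hpos).1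
  simp only [id] at h
  rw [marginalExp_isotropicSquare_cube] at h
  exact absurd marginalExp_isotropicTriangle_cube_pos (not_lt.2 h)

/-- On the unit circle the fourth moment is `9 / 5 + 12 / 5 * θ₀² θ₁²`, which is largest on the
diagonals, where `θ₀² θ₁² = 1 / 4`. -/
theorem isMaxMarginal_isotropicSquare_four :
    IsMaxMarginal isotropicSquare (fun t => t ^ 4) (12 / 5) := by
  constructor
  · refine ⟨!₂[√2 / 2, √2 / 2], ?_, ?_⟩
    · rw [mem_sphere_zero_iff_norm, EuclideanSpace.norm_eq, Real.sqrt_eq_one, Fin.sum_univ_two]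
      simp [div_pow]
      norm_num
    · have h4 : √2 ^ 4 = 4 := by
        rw [show √2 ^ 4 = (√2 ^ 2) ^ 2 by ring, Real.sq_sqrt (by norm_num)]; norm_num
      rw [marginalExp_isotropicSquare_four]
      simp [div_pow, h4]
      norm_num
  · rintro _ ⟨θ, hθ, rfl⟩
    rw [mem_sphere_zero_iff_norm, EuclideanSpace.norm_eq, Real.sqrt_eq_one, Fin.sum_univ_two] at hθ
    simp only [Real.norm_eq_abs, sq_abs] at hθ
    rw [marginalExp_isotropicSquare_four]
    nlinarith [sq_nonneg (θ 0 ^ 2 - θ 1 ^ 2)]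

theorem isMaxMarginal_isotropicTriangle_four :
    IsMaxMarginal isotropicTriangle (fun t => t ^ 4) (12 / 5) := by
  have h : ∀ θ ∈ Metric.sphere (0 : EuclideanSpace ℝ (Fin 2)) 1,
      marginalExp isotropicTriangle (fun t => t ^ 4) θ = 12 / 5 := by
    intro θ hθ
    rw [mem_sphere_zero_iff_norm, EuclideanSpace.norm_eq, Real.sqrt_eq_one, Fin.sum_univ_two] at hθ
    simp only [Real.norm_eq_abs, sq_abs] at hθ
    rw [marginalExp_isotropicTriangle_four, hθ]
    norm_num
  constructor
  · exact ⟨EuclideanSpace.single 0 1, by simp, h _ (by simp)⟩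
  · rintro _ ⟨θ, hθ, rfl⟩
    exact (h θ hθ).le

theorem theorem3 :
    -- the inequality between the maxima, and its equality cases for `k = 3`
    (∀ (n : ℕ), 1 ≤ n →
      ∀ (K Δ : Set (EuclideanSpace ℝ (Fin n))),
        IsConvexBody K → IsIsotropic K → IsSimplex Δ → IsIsotropic Δ →
      ∀ (k : ℕ), k = 3 ∨ k = 4 →
      ∀ (φ : ℝ → ℝ), ContDiff ℝ k φ → (∀ x : ℝ, 0 < iteratedDeriv k φ x) →
        ∃ M N : ℝ, IsMaxMarginal K φ M ∧ IsMaxMarginal Δ φ N ∧ M ≤ N ∧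
          (k = 3 →
            (M = N ↔ IsCone K) ∧
            (IsCone K → ∀ θ ∈ Metric.sphere (0 : EuclideanSpace ℝ (Fin n)) 1,
              marginalExp K φ θ = M →
                ∃ H : AffineSubspace ℝ (EuclideanSpace ℝ (Fin n)),
                  IsConeWithBaseIn K H ∧ θ ∈ H.directionᗮ))) ∧
    -- for `k = 4` equality may occur for a body that is not a cone
    (∃ (n : ℕ) (K Δ : Set (EuclideanSpace ℝ (Fin n))) (φ : ℝ → ℝ) (M : ℝ), 1 ≤ n ∧
      IsConvexBody K ∧ IsIsotropic K ∧ IsSimplex Δ ∧ IsIsotropic Δ ∧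
      ContDiff ℝ 4 φ ∧ (∀ x : ℝ, 0 < iteratedDeriv 4 φ x) ∧
      IsMaxMarginal K φ M ∧ IsMaxMarginal Δ φ M ∧ ¬ IsCone K) := by
  refine ⟨?_, 2, isotropicSquare, isotropicTriangle, fun t => t ^ 4, 12 / 5, by norm_num,
    isConvexBody_isotropicSquare, isIsotropic_isotropicSquare, isSimplex_isotropicTriangle,
    isIsotropic_isotropicTriangle, contDiff_id.pow 4, fun x => ?_,
    isMaxMarginal_isotropicSquare_four, isMaxMarginal_isotropicTriangle_four,
    not_isCone_isotropicSquare⟩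
  · intro n hn K Δ hK hKi hΔ hΔi k hk φ hφ hpos
    obtain ⟨p, rfl⟩ : ∃ p, n = p + 1 := ⟨n - 1, by omega⟩
    rcases hk with rfl | rfl
    · obtain ⟨M, N, hM, hN, hMN, h⟩ := exists_max_le_of_third_deriv_pos hK hKi hΔ hΔi
        (by exact_mod_cast hφ) hpos
      exact ⟨M, N, hM, hN, hMN, fun _ => h⟩
    · obtain ⟨M, N, hM, hN, hMN⟩ := exists_max_le_of_fourth_deriv_pos hK hKi hΔ hΔi
        (by exact_mod_cast hφ) hpos
      exact ⟨M, N, hM, hN, hMN, fun h => absurd h (by norm_num)⟩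
  · rw [iteratedDeriv_pow_self]
    positivity
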